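/- For a field $k$, let $K^{MW}_*(k)$ be its Milnor–Witt $K$-theory ring: the graded associative unital ring generated by symbols $[a]$ ($a\in k^*$) in degree $1$ and $\eta$ in degree $-1$, subject to $[a][b]=0$ if $a+b=1$, $[ab]=[a]+[b]+\eta[a][b]$, $[a]\eta=\eta[a]$ and $\eta(\eta[-1]+2)=0$. Write $[a_1,\dots,a_n]=[a_1]\cdots[a_n]$ (equal to $1$ for $n=0$), $\langle a\rangle=1+\eta[a]$, $\epsilon=-\langle -1\rangle$, and, for $n\ge 0$, $n_\epsilon=\sum_{i=1}^n\langle(-1)^{i-1}\rangle$ and $(-n)_\epsilon=\epsilon\, n_\epsilon$. Let $\chi^{\mathrm{odd}}:\mathbb Z\to\{0,1\}$ be the characteristic function of the set of odd integers. Let $F$ be a field with a (nontrivial) discrete valuation $v$, with valuation ring $\mathcal O_v$ and residue field $\kappa(v)$, and let $\pi$ be a uniformizing parameter; for $u\in\mathcal O_v^*$ let $\overline u\in\kappa(v)^*$ be its class. Then there is a unique morphism of graded groups $\partial^\pi_v:K^{MW}_*(F)\to K^{MW}_{*-1}(\kappa(v))$ which commutes with multiplication by $\eta$ and satisfies $\partial^\pi_v([\pi,u_1,\dots,u_n])=[\overline{u_1},\dots,\overline{u_n}]$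 and $\partial^\pi_v([u_1,\dots,u_n])=0$ for all $n\ge 0$ and $u_1,\dots,u_n\in\mathcal O_v^*$ (Morel's residue morphism), and it is given by the following formulas. For all integers $n\le 0$, all $m\in\mathbb Z$ and all $u\in\mathcal O_v^*$: $$\partial^\pi_v(\langle\pi^m u\rangle\eta^{-n})=\langle\overline u\rangle\,\eta^{-n+1}\,\chi^{\mathrm{odd}}(m).$$ For all $n\ge 1$, all $m_1,\dots,m_n\in\mathbb Z$ and all $u_1,\dots,u_n\in\mathcal O_v^*$: $$\begin{aligned}\partial^\pi_v([\pi^{m_1}u_1,\dots,\pi^{m_n}u_n])={}&\sum_{l=0}^{n-1}\ \sum_{J=\{j_1<\dots<j_l\}\subset\{1,\dots,n\}}\Big((-1)^{\sum_{i=1}^l(n-l+i-j_i)}\prod_{k\in\{1,\dots,n\}\setminus J}m_k\Big)_{\epsilon}\,[\underbrace{-1,\dots,-1}_{n-1-l},\overline{u_{j_1}},\dots,\overline{u_{j_l}}]\\&+\sum_{p=1}^n\sum_{l=p}^n\ \sum_{J=\{j_1<\dots<j_l\}\subset\{1,\dots,n\}}\Big(\sum_{I\subset\{1,\dots,l\},\,|I|=p}\eta^p\,\chi^{\mathrm{odd}}\Big(\prod_{i\in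 I}m_{j_i}\prod_{k\in\{1,\dots,n\}\setminus J}m_k\Big)\Big)\,[\underbrace{-1,\dots,-1}_{n-1+p-l},\overline{u_{j_1}},\dots,\overline{u_{j_l}}].\end{aligned}$$ -/

import Mathlib

open scoped WithZero

noncomputable section

namespace MilnorWitt

/-- The generators of the Milnor-Witt K-theory ring of a field:
a symbol for every unit `a` of `F`, and one further generator `η`. -/
inductive Gen (F : Type*) [Field F] : Type _
  | sym (a : Fˣ) : Gen F
  | eta : Gen F

/-- The degree of a generator: symbols have degree `1` and `η` has degree `-1`. -/
def Gen.deg {F : Type*} [Field F] : Gen F → ℤ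
  | .sym _ => 1
  | .eta => -1

/-- The generator `[a]` of the free associative ring. -/
def freeSym {F : Type*} [Field F] (a : Fˣ) : FreeAlgebra ℤ (Gen F) :=
  FreeAlgebra.ι ℤ (Gen.sym a)

/-- The generator `η` of the free associative ring. -/
def freeEta (F : Type*) [Field F] : FreeAlgebra ℤ (Gen F) :=
  FreeAlgebra.ι ℤ (Gen.eta : Gen F)

/-- The four families of defining relations of Milnor-Witt K-theory. -/
inductive Rel (F : Type*) [Field F] :
    FreeAlgebra ℤ (Gen F) → FreeAlgebra ℤ (Gen F) → Prop
  | steinberg (a b : Fˣ) (hab : (a : F) + (b : F) = 1) :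
      Rel F (freeSym a * freeSym b) 0
  | mul (a b : Fˣ) :
      Rel F (freeSym (a * b)) (freeSym a + freeSym b + freeEta F * (freeSym a * freeSym b))
  | comm (a : Fˣ) :
      Rel F (freeSym a * freeEta F) (freeEta F * freeSym a)
  | hyperbolic :
      Rel F (freeEta F * (freeEta F * freeSym (-1) + 2)) 0

/-- The (total) Milnor-Witt K-theory ring of a field `F`: the associative unital ring generated
by the symbols `[a]` and by `η`, subject to the relations `Rel F`. -/
def KMW (F : Type*) [Field F] : Type _ :=
  RingQuot (Rel F)

instance (F : Type*) [Field F] : Ring (KMW F) :=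
  inferInstanceAs (Ring (RingQuot (Rel F)))

/-- The quotient map from the free associative ring onto Milnor-Witt K-theory. -/
def proj (F : Type*) [Field F] : FreeAlgebra ℤ (Gen F) →+* KMW F :=
  RingQuot.mkRingHom (Rel F)

/-- The class of a generator in Milnor-Witt K-theory. -/
def gen {F : Type*} [Field F] (g : Gen F) : KMW F :=
  proj F (FreeAlgebra.ι ℤ g)

/-- The element `[a]`. -/
def sym {F : Type*} [Field F] (a : Fˣ) : KMW F :=
  gen (Gen.sym a)

/-- The element `η`. -/
def eta (F : Type*) [Field F] : KMW F :=
  gen (Gen.eta : Gen F)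

/-- The homogeneous component of degree `n`: the additive subgroup generated by the
products of generators of total degree `n`. -/
def component (F : Type*) [Field F] (n : ℤ) : AddSubgroup (KMW F) :=
  AddSubgroup.closure
    {x | ∃ w : List (Gen F), (w.map Gen.deg).sum = n ∧ x = (w.map gen).prod}

/-- The symbol `[a₁, …, aₙ] = [a₁] ⋯ [aₙ]`; the empty symbol is `1`. -/
def symbol {F : Type*} [Field F] (l : List Fˣ) : KMW F :=
  (l.map sym).prod

/-- The element `⟨a⟩ = 1 + η [a]`. -/
def angle {F : Type*} [Field F] (a : Fˣ) : KMW F :=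
  1 + eta F * sym a

/-- The element `ε = -⟨-1⟩`. -/
def eps (F : Type*) [Field F] : KMW F :=
  -angle (-1 : Fˣ)

/-- The `ε`-integer `n_ε = ∑_{i = 1}^n ⟨(-1)^(i-1)⟩` for a natural number `n`. -/
def epsNat (F : Type*) [Field F] (n : ℕ) : KMW F :=
  ∑ i ∈ Finset.Icc 1 n, angle ((-1 : Fˣ) ^ (i - 1))

/-- The `ε`-integer `n_ε` for an integer `n`, where `(-n)_ε = ε n_ε`. -/
def epsInt (F : Type*) [Field F] : ℤ → KMW F
  | Int.ofNat n => epsNat F n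
  | Int.negSucc n => eps F * epsNat F (n + 1)

/-- The characteristic function of the set of odd integers. -/
def chiOdd (m : ℤ) : ℤ :=
  if Odd m then 1 else 0

section Residue

variable {F : Type*} [Field F] (v : Valuation F ℤᵐ⁰)

/-- The residue field of a valuation. -/
abbrev ResField : Type _ :=
  IsLocalRing.ResidueField v.valuationSubring

/-- The inclusion of the units of the valuation ring into the units of the field. -/
def inclUnit : v.valuationSubringˣ →* Fˣ :=
  Units.map (v.valuationSubring.subtype : v.valuationSubring →* F)

/-- The reduction of the units of the valuation ring to the units of the residue field. -/
def redUnit : v.valuationSubringˣ →* (ResField v)ˣ :=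
  Units.map (IsLocalRing.residue v.valuationSubring : v.valuationSubring →* ResField v)

/-- The properties that characterize the residue morphism attached to the valuation `v` and to
the uniformizer `π`: it is a homomorphism of graded groups of degree `-1` which commutes
with multiplication by `η`, sends `[π, u₁, …, uₙ]` to the symbol of the reductions of the
units `u₁, …, uₙ` and kills `[u₁, …, uₙ]` (for all `n ≥ 0`). -/
structure IsResidue (π : Fˣ) (d : KMW F →+ KMW (ResField v)) : Prop where
  map_component : ∀ (n : ℤ) (x : KMW F),
    x ∈ component F n → d x ∈ component (ResField v) (n - 1)
  map_eta_mul : ∀ x : KMW F, d (eta F * x) = eta (ResField v) * d x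
  map_uniformizer : ∀ us : List v.valuationSubringˣ,
    d (symbol (π :: us.map (inclUnit v))) = symbol (us.map (redUnit v))
  map_units : ∀ us : List v.valuationSubringˣ,
    d (symbol (us.map (inclUnit v))) = 0

end Residue

end MilnorWitt

end

open scoped WithZero

noncomputable section

namespace MilnorWitt

/-! ### Generators, relations and the universal property. -/

section Presentation

variable {F : Type*} [Field F]

/-! Existence. Adjoin to `KMW (ResField v)` an element `ξ` that imitates `[π]`: it commutes with
`η`, ε-commutes with symbols and satisfies `ξ² = ξ[-1]`. In a ring with such an element, `[π^m u] ↦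
[ū] + m_ε ξ + χ(m) η ξ [ū]` respects the Milnor–Witt relations (`exists_hom_of_isUniformizing`). The
multiplication rule is an interchange law for the operation `x + y + η x y`. The Steinberg relation
`a + b = 1` splits according to valuations: either both are units, or one of them reduces to `1`, or
both have the same negative valuation and opposite leading coefficients, which is the case of
`ramifiedSym_mul_neg`. A free extension with basis `1, ξ` is realized by 2×2 matrices
(`isUniformizing_ramifiedRoot`), and the residue of `x` is the coefficient of `ξ`, the `(1,0)` entry
of the image of `x`.

Uniqueness. The elements `η^i [u₁,…,uₙ]` and `η^i [π,u₁,…,uₙ]` span `KMW F` additively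
(`mem_unitSpan`), and the defining properties fix the residue on them.

Formulas. In `KMW F` itself `[π^m u] = [u] + m_ε [π] + χ(m) η [π][u]` (`sym_zpow_mul`). A product of
such symbols is expanded over the set `J` of factors that keep their unit, and the powers of `[π]`
are moved to the left; each crossing of a unit symbol costs one `ε` (`symbol_ofFn_zpow_mul`). Inside
the factors of `J` one chooses the subset `I` that contributes `η[π]`. Then `[π]^(r+1) = [π][-1]^r`
makes the residue readable. Terms with `I` empty give the first sum. When `I` is nonempty a factor
`η` turns every ε-integer into its parity, which gives the second sum. -/

theorem proj_surjective : Function.Surjective (proj F) :=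
  RingQuot.mkRingHom_surjective (Rel F)

theorem proj_freeSym (a : Fˣ) : proj F (freeSym a) = sym a := rfl

theorem proj_freeEta : proj F (freeEta F) = eta F := rfl

theorem proj_eq_of_rel {x y : FreeAlgebra ℤ (Gen F)} (h : Rel F x y) : proj F x = proj F y :=
  RingQuot.mkRingHom_rel h

theorem sym_mul_sym_of_add_eq_one {a b : Fˣ} (h : (a : F) + b = 1) : sym a * sym b = 0 := by
  simpa [proj_freeSym] using proj_eq_of_rel (Rel.steinberg a b h)

theorem sym_mul (a b : Fˣ) : sym (a * b) = sym a + sym b + eta F * (sym a * sym b) := by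
  simpa [proj_freeSym, proj_freeEta] using proj_eq_of_rel (Rel.mul a b)

theorem sym_mul_eta (a : Fˣ) : sym a * eta F = eta F * sym a := by
  simpa [proj_freeSym, proj_freeEta] using proj_eq_of_rel (Rel.comm a)

theorem eta_mul_hyperbolic : eta F * (eta F * sym (-1) + 2) = 0 := by
  have h := proj_eq_of_rel (Rel.hyperbolic (F := F))
  rwa [map_mul, map_add, map_mul, map_zero, map_ofNat, proj_freeSym, proj_freeEta] at h

/-- To prove a property of all elements of Milnor-Witt K-theory, it suffices to check it on
integers and generators, and its stability under sums and products. -/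
theorem KMW.induction {P : KMW F → Prop} (int : ∀ n : ℤ, P n) (sym : ∀ a : Fˣ, P (sym a))
    (eta : P (eta F)) (add : ∀ x y, P x → P y → P (x + y)) (mul : ∀ x y, P x → P y → P (x * y))
    (x : KMW F) : P x := by
  obtain ⟨x, rfl⟩ := proj_surjective x
  induction x using FreeAlgebra.induction with
  | grade0 r => simpa using int r
  | grade1 g =>
    cases g with
    | sym a => exact sym a
    | eta => exact eta
  | mul x y hx hy => simpa using mul _ _ hx hy
  | add x y hx hy => simpa using add _ _ hx hy

/-- The universal property of Milnor-Witt K-theory. -/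
def KMW.lift {R : Type*} [Ring R] (s : Fˣ → R) (e : R)
    (steinberg : ∀ a b : Fˣ, (a : F) + (b : F) = 1 → s a * s b = 0)
    (mul : ∀ a b : Fˣ, s (a * b) = s a + s b + e * (s a * s b))
    (comm : ∀ a : Fˣ, s a * e = e * s a) (hyperbolic : e * (e * s (-1) + 2) = 0) :
    KMW F →+* R :=
  RingQuot.lift ⟨(FreeAlgebra.lift ℤ (fun g : Gen F => Gen.casesOn g s e) :
    FreeAlgebra ℤ (Gen F) →ₐ[ℤ] R).toRingHom, by
      intro x y h
      cases h with
      | steinberg a b hab => simpa [freeSym] using steinberg a b hab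
      | mul a b => simpa [freeSym, freeEta] using mul a b
      | comm a => simpa [freeSym, freeEta] using comm a
      | hyperbolic =>
        rw [← one_add_one_eq_two] at hyperbolic ⊢
        simpa [freeSym, freeEta] using hyperbolic⟩

section

variable {R : Type*} [Ring R] {s : Fˣ → R} {e : R}
    (h₁ : ∀ a b : Fˣ, (a : F) + (b : F) = 1 → s a * s b = 0)
    (h₂ : ∀ a b : Fˣ, s (a * b) = s a + s b + e * (s a * s b))
    (h₃ : ∀ a : Fˣ, s a * e = e * s a) (h₄ : e * (e * s (-1) + 2) = 0)

theorem KMW.lift_sym (a : Fˣ) : KMW.lift s e h₁ h₂ h₃ h₄ (MilnorWitt.sym a) = s a := by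
  refine (RingQuot.lift_mkRingHom_apply _ _ _).trans ?_
  simp

theorem KMW.lift_eta : KMW.lift s e h₁ h₂ h₃ h₄ (MilnorWitt.eta F) = e := by
  refine (RingQuot.lift_mkRingHom_apply _ _ _).trans ?_
  simp

end

end Presentation

/-! ### Identities in Milnor–Witt K-theory, up to ε-commutativity. -/

section Basic

variable {F : Type*} [Field F]

theorem commute_eta (x : KMW F) : Commute (eta F) x := by
  induction x using KMW.induction with
  | int n => exact Int.commute_cast _ _
  | sym a => exact (sym_mul_eta a).symm
  | eta => exact Commute.refl _
  | add x y hx hy => exact hx.add_right hy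
  | mul x y hx hy => exact hx.mul_right hy

theorem mul_eta (x : KMW F) : x * eta F = eta F * x := (commute_eta x).eq.symm

theorem mul_eta_mul (x y : KMW F) : x * (eta F * y) = eta F * (x * y) := by
  rw [← mul_assoc, mul_eta, mul_assoc]

theorem eta_mul_eta_mul_sym_neg_one : eta F * (eta F * sym (-1)) = -2 * eta F := by
  have := eta_mul_hyperbolic (F := F)
  rw [mul_add, mul_two] at this
  rw [eq_neg_of_add_eq_zero_left this]
  noncomm_ring

theorem angle_mul (a b : Fˣ) : angle (a * b) = angle a * angle b := by
  simp only [angle, sym_mul, mul_add, add_mul, one_mul, mul_one, mul_assoc, mul_eta_mul]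
  abel

theorem angle_neg_one_mul_self : angle (-1 : Fˣ) * angle (-1) = 1 := by
  simp only [angle, mul_add, add_mul, one_mul, mul_one, mul_assoc, mul_eta_mul]
  rw [← mul_assoc (eta F) (sym _), ← mul_assoc (eta F) (_ * _), eta_mul_eta_mul_sym_neg_one]
  noncomm_ring

theorem angle_one : angle (1 : Fˣ) = 1 := by
  rw [← angle_neg_one_mul_self, ← angle_mul]
  simp

/-- Since `⟨1⟩ = 1`, the term `η[1][1]` vanishes, and `[1·1] = [1] + [1]` remains. -/
theorem sym_one : sym (1 : Fˣ) = 0 := by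
  have h := sym_mul (1 : Fˣ) 1
  have h' := congrArg (· * sym (1 : Fˣ)) (angle_one (F := F))
  simp only [angle, add_mul, one_mul, mul_assoc, add_eq_left] at h'
  rw [h', mul_one, add_zero] at h
  simpa using h

/-- Compare the expansions of `[ab]` and `[ba]`. -/
theorem eta_mul_sym_mul_sym_comm (a b : Fˣ) :
    eta F * (sym a * sym b) = eta F * (sym b * sym a) := by
  have h := sym_mul a b
  rw [mul_comm, sym_mul b a, add_comm (sym b)] at h
  exact (add_left_cancel h).symm

theorem commute_angle (c : Fˣ) (x : KMW F) : Commute (angle c) x := by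
  refine (Commute.one_left x).add_left ?_
  induction x using KMW.induction with
  | int n => exact Int.commute_cast _ _
  | sym a =>
    show _ * _ = _ * _
    rw [mul_assoc, mul_eta_mul, eta_mul_sym_mul_sym_comm]
  | eta => exact (commute_eta _).symm
  | add x y hx hy => exact hx.add_right hy
  | mul x y hx hy => exact hx.mul_right hy

theorem mul_angle (x : KMW F) (c : Fˣ) : x * angle c = angle c * x := (commute_angle c x).eq.symm

theorem mul_angle_mul (x y : KMW F) (c : Fˣ) : x * (angle c * y) = angle c * (x * y) := by
  rw [← mul_assoc, mul_angle, mul_assoc]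

theorem sym_mul' (a b : Fˣ) : sym (a * b) = sym a + angle a * sym b := by
  rw [sym_mul, angle, add_mul, one_mul, mul_assoc, add_assoc]

theorem sym_mul_sym_neg (a : Fˣ) : sym a * sym (-a) = 0 := by
  by_cases ha : (a : F) = 1
  · have : a = 1 := Units.ext ha
    rw [this, sym_one, zero_mul]
  have h1 : (1 - a : F) ≠ 0 := sub_ne_zero.mpr (Ne.symm ha)
  have h2 : (1 - (a : F)⁻¹) ≠ 0 := by
    rw [sub_ne_zero]; intro h; exact ha (inv_eq_one.mp h.symm)
  set b : Fˣ := Units.mk0 _ h1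
  set c : Fˣ := Units.mk0 _ h2
  -- With `b = 1 - a` and `c = 1 - a⁻¹`, the Steinberg relations for `a` and for `a⁻¹` both apply;
  -- since `[a]` is a multiple of `[a⁻¹]`, it kills `[c]` as well, so that only `[a][-a]` survives
  -- in `[a][b]`.
  have hb : b = -a * c := by
    ext; simp [b, c]; field_simp; ring
  have hab : sym a * sym b = 0 := sym_mul_sym_of_add_eq_one (by simp [b])
  have hac : sym a⁻¹ * sym c = 0 := sym_mul_sym_of_add_eq_one (by simp [c])
  have ha' : sym a = -(angle a * sym a⁻¹) := by
    rw [eq_neg_iff_add_eq_zero, ← sym_mul', mul_inv_cancel, sym_one]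
  have hac' : sym a * sym c = 0 := by
    rw [ha', neg_mul, mul_assoc, hac, mul_zero, neg_zero]
  rw [hb, sym_mul', mul_add, mul_angle_mul, hac', mul_zero, add_zero] at hab
  exact hab

theorem angle_neg_one_mul_sym_neg_one : angle (-1 : Fˣ) * sym (-1) = - sym (-1) := by
  rw [eq_neg_iff_add_eq_zero, add_comm, ← sym_mul']
  simp [sym_one]

/-- Expand `[-a] = [-1] + ⟨-1⟩[a]` in `[a][-a] = 0` and multiply by the involution `⟨-1⟩`. -/
theorem sym_mul_self (a : Fˣ) : sym a * sym a = sym a * sym (-1) := by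
  have h := sym_mul_sym_neg a
  rw [neg_eq_neg_one_mul a, sym_mul', mul_add, mul_angle_mul] at h
  have h' := congrArg (angle (-1 : Fˣ) * ·) h
  simp only [mul_add, ← mul_assoc, angle_neg_one_mul_self, one_mul, mul_zero] at h'
  rw [← mul_angle, mul_assoc, angle_neg_one_mul_sym_neg_one, mul_neg] at h'
  rwa [neg_add_eq_zero, eq_comm] at h'

theorem angle_mul_self (a : Fˣ) : angle a * angle a = 1 := by
  have h : eta F * (eta F * (sym a * sym a)) = -2 * (eta F * sym a) := by
    rw [sym_mul_self, eta_mul_sym_mul_sym_comm, ← mul_assoc (eta F) (sym _),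
      ← mul_assoc (eta F) (_ * _), eta_mul_eta_mul_sym_neg_one]
    noncomm_ring
  simp only [angle, mul_add, add_mul, one_mul, mul_one, mul_assoc, mul_eta_mul, h]
  noncomm_ring

theorem angle_neg (a : Fˣ) : angle (-a) = angle (-1) * angle a := by
  rw [← angle_mul, neg_one_mul]

/-- Expanding `[ab][-ab] = 0` leaves, up to the invertible factor `⟨a⟩`, the sum of the two sides'
difference; this is ε-commutativity. -/
theorem angle_neg_one_mul_sym_mul_sym (a b : Fˣ) :
    angle (-1) * (sym a * sym b) = - (sym b * sym a) := by
  have key (x : KMW F) : angle a * (angle a * x) = x := by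
    rw [← mul_assoc, angle_mul_self, one_mul]
  have h₁ : sym (-a) = sym a + angle a * sym (-1) := by
    rw [← sym_mul', mul_neg_one]
  have h₂ : angle (-1 : Fˣ) * (sym b * sym (-1)) = - (sym b * sym (-1)) := by
    rw [← mul_angle_mul, angle_neg_one_mul_sym_neg_one, mul_neg]
  have h := sym_mul_sym_neg (a * b)
  rw [← neg_mul, sym_mul', sym_mul', add_mul, mul_add, mul_add, sym_mul_sym_neg, zero_add,
    mul_angle_mul (sym a), mul_assoc (angle a) (sym b), mul_assoc (angle a) (sym b),
    mul_angle_mul (sym b), sym_mul_self b, h₁, mul_add, mul_add, mul_angle_mul (sym b), key,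
    angle_neg, ← mul_angle (angle a), mul_assoc (angle a) (angle (-1)),
    mul_assoc (angle a) (angle (-1)), h₂, mul_neg, mul_neg, key, add_assoc, add_neg_cancel,
    add_zero, ← mul_add] at h
  rw [eq_neg_iff_add_eq_zero, ← key (_ + _), h, mul_zero]

theorem sym_mul_sym_comm (a b : Fˣ) : sym a * sym b = eps F * (sym b * sym a) := by
  rw [eps, neg_mul, angle_neg_one_mul_sym_mul_sym, neg_neg]

theorem commute_eps (x : KMW F) : Commute (eps F) x := (commute_angle _ x).neg_left

theorem mul_eps (x : KMW F) : x * eps F = eps F * x := (commute_eps x).eq.symm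

theorem eps_mul_eta : eps F * eta F = eta F := by
  rw [eps, angle, neg_mul, add_mul, mul_assoc, sym_mul_eta, eta_mul_eta_mul_sym_neg_one]
  noncomm_ring

theorem eps_mul_sym_neg_one : eps F * sym (-1) = sym (-1) := by
  rw [eps, neg_mul, angle_neg_one_mul_sym_neg_one, neg_neg]

end Basic

/-! ### Arithmetic of ε-integers and parity. -/

section EpsilonIntegers

theorem chiOdd_eq (m : ℤ) : chiOdd m = m - 2 * (m / 2) := by
  unfold chiOdd
  split_ifs with h
  · obtain ⟨k, rfl⟩ := h; omega
  · obtain ⟨k, rfl⟩ := Int.not_odd_iff_even.mp h; omega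

theorem chiOdd_mul (m n : ℤ) : chiOdd (m * n) = chiOdd m * chiOdd n := by
  unfold chiOdd
  simp only [Int.odd_mul]
  split_ifs <;> simp_all

theorem chiOdd_prod {ι : Type*} (s : Finset ι) (m : ι → ℤ) :
    chiOdd (∏ i ∈ s, m i) = ∏ i ∈ s, chiOdd (m i) := by
  induction s using Finset.cons_induction with
  | empty => simp [chiOdd]
  | cons a s ha ih => rw [Finset.prod_cons, Finset.prod_cons, chiOdd_mul, ih]

theorem chiOdd_neg_one_pow_mul (k : ℕ) (m : ℤ) : chiOdd ((-1) ^ k * m) = chiOdd m := by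
  have h : chiOdd ((-1) ^ k) = 1 := if_pos (Odd.pow (by decide))
  rw [chiOdd_mul, h, one_mul]

theorem add_ediv_two (m n : ℤ) : (m + n) / 2 = m / 2 + n / 2 + chiOdd m * chiOdd n := by
  unfold chiOdd
  split_ifs with h h' h' <;> simp only [Int.odd_iff] at * <;> omega

theorem mul_ediv_two (m n : ℤ) :
    (m * n) / 2 = m * (n / 2) + n * (m / 2) - 2 * ((m / 2) * (n / 2)) := by
  have h := chiOdd_mul m n
  simp only [chiOdd_eq] at h
  linarith

variable {F : Type*} [Field F]

theorem eta_sym_neg_one_sq :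
    eta F * sym (-1) * (eta F * sym (-1)) = -2 * (eta F * sym (-1)) := by
  rw [mul_assoc, mul_eta_mul, ← mul_assoc (eta F) (sym _), ← mul_assoc (eta F) (_ * _), eta_mul_eta_mul_sym_neg_one]
  noncomm_ring

theorem angle_neg_one_pow (k : ℕ) :
    angle ((-1 : Fˣ) ^ k) = 1 + (chiOdd k : KMW F) * (eta F * sym (-1)) := by
  unfold chiOdd
  rcases Nat.even_or_odd k with h | h
  · simp [h, angle_one]
  · simp [h, angle]

theorem epsNat_eq (n : ℕ) :
    epsNat F n = (n : KMW F) + ((n / 2 : ℕ) : KMW F) * (eta F * sym (-1)) := by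
  induction n with
  | zero => simp [epsNat]
  | succ n ih =>
    have h : (n + 1) / 2 = n / 2 + (if Odd (n : ℤ) then 1 else 0) := by
      split_ifs with h
      all_goals simp only [Int.odd_iff] at h; omega
    have hs : epsNat F (n + 1) = epsNat F n + angle ((-1 : Fˣ) ^ n) := by
      rw [epsNat, Finset.sum_Icc_succ_top (by omega)]; rfl
    rw [hs, ih, angle_neg_one_pow, h, chiOdd]
    split_ifs <;> push_cast <;> noncomm_ring

/-- The summands of `n_ε` alternate between `1` and `1 + η[-1]`. With floor division the same closed
form covers negative `m`, and the laws for sums and products become identities for `m / 2`. -/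
theorem epsInt_eq (m : ℤ) :
    epsInt F m = (m : KMW F) + ((m / 2 : ℤ) : KMW F) * (eta F * sym (-1)) := by
  cases m with
  | ofNat n =>
    have h : Int.ofNat n / 2 = ((n / 2 : ℕ) : ℤ) := rfl
    rw [epsInt, epsNat_eq, h, Int.ofNat_eq_natCast, Int.cast_natCast, Int.cast_natCast]
  | negSucc n =>
    -- The floor of `-N/2` equals `-N + ⌊N/2⌋`, which matches the effect of `ε = -1 - η[-1]` because
    -- `(η[-1])² = -2η[-1]`.
    have h : (Int.negSucc n) / 2 = - ((n + 1 : ℕ) : ℤ) + ((n + 1) / 2 : ℕ) := by omega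
    rw [epsInt, epsNat_eq, h]
    generalize (n + 1) / 2 = r
    rw [eps, angle, neg_mul, add_mul, mul_add, mul_add, one_mul, one_mul,
      ← (Nat.cast_commute _ (eta F * sym (-1))).eq, ← mul_assoc _ _ (eta F * sym (-1)),
      ← (Nat.cast_commute _ (eta F * sym (-1))).eq, mul_assoc _ _ (eta F * sym (-1)),
      eta_sym_neg_one_sq]
    push_cast [Int.negSucc_eq]
    noncomm_ring

theorem commute_epsInt (m : ℤ) (x : KMW F) : Commute (epsInt F m) x := by
  have h : eta F * sym (-1) = angle (-1) - 1 := by rw [angle, add_sub_cancel_left]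
  rw [epsInt_eq, h]
  exact (Int.cast_commute _ _).add_left
    ((Int.cast_commute _ _).mul_left ((commute_angle _ _).sub_left (Commute.one_left _)))

theorem epsInt_add (m n : ℤ) : epsInt F (m + n) =
    epsInt F m + epsInt F n + ((chiOdd m * chiOdd n : ℤ) : KMW F) * (eta F * sym (-1)) := by
  simp only [epsInt_eq, add_ediv_two]
  push_cast
  noncomm_ring

theorem epsInt_mul (m n : ℤ) : epsInt F (m * n) = epsInt F m * epsInt F n := by
  simp only [epsInt_eq, mul_ediv_two, mul_add, add_mul]
  rw [← (Int.cast_commute n (_ * (eta F * sym (-1)))).eq, mul_assoc _ (eta F * sym (-1)),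
    ← mul_assoc (eta F * sym (-1)), ← (Int.cast_commute _ (eta F * sym (-1))).eq,
    mul_assoc _ (eta F * sym (-1)) (eta F * sym (-1)), eta_sym_neg_one_sq]
  have h₂ : (-2 : KMW F) = ((-2 : ℤ) : KMW F) := by norm_num
  rw [h₂]
  simp only [← mul_assoc, ← Int.cast_mul, add_assoc, ← add_mul, ← Int.cast_add]
  congr 4
  ring

theorem epsInt_zero : epsInt F 0 = 0 := by simp [epsInt_eq]

theorem epsInt_one : epsInt F 1 = 1 := by simp [epsInt_eq]

theorem epsInt_neg_one : epsInt F (-1) = eps F := by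
  rw [epsInt_eq, eps, angle]
  norm_num
  abel

theorem epsInt_neg_one_pow (k : ℕ) : epsInt F ((-1) ^ k) = eps F ^ k := by
  induction k with
  | zero => simp [epsInt_one]
  | succ k ih => rw [pow_succ, epsInt_mul, ih, epsInt_neg_one, pow_succ]

/-- The relation `η²[-1] = -2η` reduces `m + (m/2)η[-1]` to `m - 2(m/2)`. This is the source of
every parity function in the formulas. -/
theorem eta_mul_epsInt (m : ℤ) : eta F * epsInt F m = (chiOdd m : KMW F) * eta F := by
  rw [epsInt_eq, chiOdd_eq, mul_add, ← mul_assoc (eta F), ← (Int.cast_commute _ (eta F)).eq,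
    ← (Int.cast_commute _ (eta F)).eq, mul_assoc _ (eta F) (_ * _), eta_mul_eta_mul_sym_neg_one]
  push_cast
  noncomm_ring

theorem eta_mul_sym_neg_one_mul_sym_neg_one :
    eta F * (sym (-1) * sym (-1)) = -2 * sym (-1) := by
  have h := sym_mul (-1 : Fˣ) (-1)
  rw [neg_mul_neg, one_mul, sym_one] at h
  linear_combination (norm := noncomm_ring) -h

theorem epsInt_mul_sym_neg_one (m : ℤ) :
    epsInt F m * sym (-1) = (chiOdd m : KMW F) * sym (-1) := by
  rw [epsInt_eq, chiOdd_eq, add_mul, mul_assoc, mul_assoc, eta_mul_sym_neg_one_mul_sym_neg_one]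
  push_cast
  noncomm_ring

end EpsilonIntegers

/-! ### Formal uniformizers and the symbols they generate. -/

section Uniformizing

variable {k : Type*} [Field k] {R : Type*} [Ring R]

/-- An element `ξ` of a ring over Milnor-Witt K-theory that behaves like the symbol of a
uniformizer: it commutes with `η`, it `ε`-commutes with symbols, and `ξ ^ 2 = ξ [-1]`. -/
structure IsUniformizing (φ : KMW k →+* R) (ξ : R) : Prop where
  eta_comm : ξ * φ (eta k) = φ (eta k) * ξ
  sym_comm : ∀ u : kˣ, φ (sym u) * ξ = φ (eps k) * (ξ * φ (sym u))
  sq : ξ * ξ = ξ * φ (sym (-1))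

/-- The element `[u] + m_ε ξ + χ(m) η ξ [u]`, which behaves like the symbol `[π ^ m u]`. -/
def ramifiedSym (φ : KMW k →+* R) (ξ : R) (m : ℤ) (u : kˣ) : R :=
  φ (sym u) + φ (epsInt k m) * ξ + (chiOdd m : R) * (φ (eta k) * (ξ * φ (sym u)))

namespace IsUniformizing

variable {φ : KMW k →+* R} {ξ : R} (h : IsUniformizing φ ξ)
include h

theorem eta_sym_comm (u : kˣ) :
    φ (eta k) * (φ (sym u) * ξ) = φ (eta k) * (ξ * φ (sym u)) := by
  rw [h.sym_comm, ← mul_assoc, ← map_mul, mul_eps, eps_mul_eta]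

theorem commute_eta_mul_sym (u : kˣ) : Commute (φ (eta k) * φ (sym u)) ξ := by
  show _ * _ = _ * _
  rw [mul_assoc, h.eta_sym_comm, ← mul_assoc, ← h.eta_comm, mul_assoc]

theorem commute_epsInt (m : ℤ) : Commute (φ (epsInt k m)) ξ := by
  rw [epsInt_eq, map_add, map_mul, map_mul, map_intCast, map_intCast]
  exact (Int.cast_commute _ _).add_left ((Int.cast_commute _ _).mul_left
    (h.commute_eta_mul_sym (-1)))

/-- The correction term in `epsInt_add` is exactly what `ξ² = ξ[-1]` produces, so `m ↦ m_ε ξ` turns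
addition into the operation `x + y + η x y`, as `m ↦ [π^m]` must. -/
theorem epsInt_add_mul (m n : ℤ) : φ (epsInt k (m + n)) * ξ =
    φ (epsInt k m) * ξ + φ (epsInt k n) * ξ +
      φ (eta k) * ((φ (epsInt k m) * ξ) * (φ (epsInt k n) * ξ)) := by
  have h₁ : (φ (epsInt k m) * ξ) * (φ (epsInt k n) * ξ) =
      φ (epsInt k m) * (φ (epsInt k n) * (ξ * ξ)) := by
    rw [mul_assoc, ← mul_assoc ξ, ← (h.commute_epsInt n).eq, mul_assoc]
  have h₂ (n : ℤ) (x : R) : φ (eta k) * (φ (epsInt k n) * x) =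
      (chiOdd n : R) * (φ (eta k) * x) := by
    rw [← mul_assoc, ← map_mul, eta_mul_epsInt, map_mul, map_intCast, mul_assoc]
  rw [h₁, h₂, h₂, epsInt_add, h.sq, map_add, map_add, add_mul, add_mul, map_mul, map_mul,
    map_intCast, mul_assoc _ _ ξ, mul_assoc _ _ ξ, h.eta_sym_comm, Int.cast_mul, mul_assoc]

end IsUniformizing

/-- Writing `x ∘ y = x + y + e x y`, this is `(s ∘ t) ∘ (c ∘ d) = (s ∘ c) ∘ (t ∘ d)`; only the two
middle terms need to commute, and only after multiplication by `e`. -/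
theorem circ_interchange {e s t c d : R} (hs : Commute e s) (ht : Commute e t) (hc : Commute e c)
    (h : e * (t * c) = e * (c * t)) :
    (s + t + e * (s * t)) + (c + d + e * (c * d)) +
        e * ((s + t + e * (s * t)) * (c + d + e * (c * d))) =
      (s + c + e * (s * c)) + (t + d + e * (t * d)) +
        e * ((s + c + e * (s * c)) * (t + d + e * (t * d))) := by
  have pull {a : R} (ha : Commute e a) (x : R) : a * (e * x) = e * (a * x) := by
    rw [← mul_assoc, ← ha.eq, mul_assoc]
  have h₁ : e * (s * (t * c)) = e * (s * (c * t)) := by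
    rw [← pull hs, h, pull hs]
  have h₂ : e * (t * (c * d)) = e * (c * (t * d)) := by
    simpa only [mul_assoc] using congrArg (· * d) h
  have h₃ : e * (s * (t * (c * d))) = e * (s * (c * (t * d))) := by
    rw [← pull hs, h₂, pull hs]
  simp only [mul_add, add_mul, mul_assoc, pull hs, pull ht, pull hc]
  rw [h, h₁, h₂, h₃]
  abel

namespace IsUniformizing

variable {φ : KMW k →+* R} {ξ : R} (h : IsUniformizing φ ξ)

theorem commute_eta_map (φ : KMW k →+* R) (x : KMW k) : Commute (φ (eta k)) (φ x) :=
  (commute_eta x).map φ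

theorem eta_mul_epsInt_mul (φ : KMW k →+* R) (m : ℤ) (x : R) :
    φ (eta k) * (φ (epsInt k m) * x) = (chiOdd m : R) * (φ (eta k) * x) := by
  rw [← mul_assoc, ← map_mul, eta_mul_epsInt, map_mul, map_intCast, mul_assoc]

/-- This exhibits the symbol as `(m_ε ξ) ∘ [u]` for `x ∘ y = x + y + η x y`, the form in which
`circ_interchange` yields multiplicativity. -/
theorem ramifiedSym_eq (m : ℤ) (u : kˣ) : ramifiedSym φ ξ m u =
    φ (epsInt k m) * ξ + φ (sym u) + φ (eta k) * (φ (epsInt k m) * ξ * φ (sym u)) := by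
  rw [ramifiedSym, mul_assoc _ ξ, eta_mul_epsInt_mul, add_comm (φ (sym u))]

include h

theorem commute_eta_epsInt_mul (m : ℤ) : Commute (φ (eta k)) (φ (epsInt k m) * ξ) :=
  (commute_eta_map φ _).mul_right h.eta_comm.symm

theorem ramifiedSym_mul (m n : ℤ) (u w : kˣ) : ramifiedSym φ ξ (m + n) (u * w) =
    ramifiedSym φ ξ m u + ramifiedSym φ ξ n w +
      φ (eta k) * (ramifiedSym φ ξ m u * ramifiedSym φ ξ n w) := by
  simp only [ramifiedSym_eq, h.epsInt_add_mul, sym_mul, map_add, map_mul]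
  refine circ_interchange (h.commute_eta_epsInt_mul m) (h.commute_eta_epsInt_mul n)
    (commute_eta_map φ _) ?_
  rw [mul_assoc _ ξ, ← mul_assoc (φ (sym u)), ← ((MilnorWitt.commute_epsInt n _).map φ).eq,
    mul_assoc _ (φ (sym u)), eta_mul_epsInt_mul, eta_mul_epsInt_mul, h.eta_sym_comm]

theorem ramifiedSym_comm_eta (m : ℤ) (u : kˣ) :
    ramifiedSym φ ξ m u * φ (eta k) = φ (eta k) * ramifiedSym φ ξ m u := by
  refine Commute.eq (Commute.symm ?_)
  rw [ramifiedSym_eq]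
  have h₁ := h.commute_eta_epsInt_mul m
  have h₂ := commute_eta_map φ (sym u)
  exact (h₁.add_right h₂).add_right ((Commute.refl _).mul_right (h₁.mul_right h₂))

/-- The analogue of `[a][-a] = 0`. It cannot be deduced from Steinberg relations, since the target
is an abstract ring; the nine products are normalized to multiples of a few monomials, with `η`,
parities and `ξ` moved left, and cancel. -/
theorem ramifiedSym_mul_neg (m : ℤ) (u : kˣ) :
    ramifiedSym φ ξ m u * ramifiedSym φ ξ m (-u) = 0 := by
  have hcc : φ (sym u) * φ (sym (-u)) = 0 := by rw [← map_mul, sym_mul_sym_neg, map_zero]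
  have hu : φ (sym (-u)) =
      φ (sym (-1)) + φ (sym u) + φ (eta k) * (φ (sym (-1)) * φ (sym u)) := by
    rw [neg_eq_neg_one_mul, sym_mul, map_add, map_add, map_mul, map_mul]
  have hEc (x : R) : φ (eta k) * (φ (sym u) * (ξ * x)) = φ (eta k) * (ξ * (φ (sym u) * x)) := by
    simpa only [mul_assoc] using congrArg (· * x) (h.eta_sym_comm u)
  have hMξ (x : R) : ξ * (φ (epsInt k m) * x) = φ (epsInt k m) * (ξ * x) := by
    rw [← mul_assoc, ← (h.commute_epsInt m).eq, mul_assoc]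
  have hMc (x : R) : φ (sym u) * (φ (epsInt k m) * x) = φ (epsInt k m) * (φ (sym u) * x) := by
    rw [← mul_assoc, ← ((MilnorWitt.commute_epsInt m _).map φ).eq, mul_assoc]
  have hME (x : R) : φ (epsInt k m) * (φ (eta k) * x) = (chiOdd m : R) * (φ (eta k) * x) := by
    rw [← eta_mul_epsInt_mul, ← mul_assoc, ← mul_assoc, (commute_eta_map φ _).eq]
  have hEξ (x : R) : ξ * (φ (eta k) * x) = φ (eta k) * (ξ * x) := by
    rw [← mul_assoc, h.eta_comm, mul_assoc]
  have hEc' (x : R) : φ (sym u) * (φ (eta k) * x) = φ (eta k) * (φ (sym u) * x) := by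
    rw [← mul_assoc, ← (commute_eta_map φ _).eq, mul_assoc]
  have hMq : φ (epsInt k m) * φ (sym (-1)) = (chiOdd m : R) * φ (sym (-1)) := by
    rw [← map_mul, epsInt_mul_sym_neg_one, map_mul, map_intCast]
  have hX (x : R) : (chiOdd m : R) * ((chiOdd m : R) * x) = (chiOdd m : R) * x := by
    unfold chiOdd; split_ifs <;> simp
  have hXl (a x : R) : a * ((chiOdd m : R) * x) = (chiOdd m : R) * (a * x) := by
    rw [← mul_assoc, ← (Int.cast_commute _ a).eq, mul_assoc]
  have hEqq : φ (eta k) * (φ (sym (-1)) * φ (sym (-1))) = -2 * φ (sym (-1)) := by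
    rw [← map_mul, ← map_mul, eta_mul_sym_neg_one_mul_sym_neg_one, map_mul, map_neg, map_ofNat]
  have hEqξ (x : R) : φ (eta k) * (φ (sym (-1)) * (ξ * x)) =
      φ (eta k) * (ξ * (φ (sym (-1)) * x)) := by
    simpa only [mul_assoc] using congrArg (· * x) (h.eta_sym_comm (-1))
  have hε (x : R) : φ (eps k) * x = -x - φ (eta k) * (φ (sym (-1)) * x) := by
    rw [eps, angle, map_neg, map_add, map_one, map_mul]
    noncomm_ring
  have hMξq : φ (epsInt k m) * (ξ * φ (sym (-1))) = (chiOdd m : R) * (ξ * φ (sym (-1))) := by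
    rw [← hMξ, hMq, hXl]
  have hξξ (x : R) : ξ * (ξ * x) = ξ * (φ (sym (-1)) * x) := by
    rw [← mul_assoc, h.sq, mul_assoc]
  have p₁ : φ (sym u) * (φ (epsInt k m) * ξ) = -(φ (epsInt k m) * (ξ * φ (sym u))) -
      (chiOdd m : R) * (φ (eta k) * (ξ * (φ (sym (-1)) * φ (sym u)))) := by
    rw [hMc, h.sym_comm, hε, mul_sub, mul_neg, hME, hEqξ]
  have p₂ : φ (sym u) * ((chiOdd m : R) * (φ (eta k) * (ξ * φ (sym (-u))))) = 0 := by
    rw [hXl, hEc', hEc, hcc, mul_zero, mul_zero, mul_zero]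
  have p₃ : φ (epsInt k m) * ξ * φ (sym (-u)) = (chiOdd m : R) * (ξ * φ (sym (-1))) +
      φ (epsInt k m) * (ξ * φ (sym u)) +
      (chiOdd m : R) * (φ (eta k) * (ξ * (φ (sym (-1)) * φ (sym u)))) := by
    rw [hu, mul_assoc, mul_add, mul_add, mul_add, mul_add, hMξq, hEξ, hME]
  have p₄ : φ (epsInt k m) * ξ * (φ (epsInt k m) * ξ) = (chiOdd m : R) * (ξ * φ (sym (-1))) := by
    rw [mul_assoc, hMξ, h.sq, hMξq, hXl, hMξq, hX]
  have p₅ : φ (epsInt k m) * ξ * ((chiOdd m : R) * (φ (eta k) * (ξ * φ (sym (-u))))) =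
      -2 * ((chiOdd m : R) * (ξ * φ (sym (-1)))) -
      (chiOdd m : R) * (φ (eta k) * (ξ * (φ (sym (-1)) * φ (sym u)))) := by
    have e₁ : φ (eta k) * (ξ * (φ (sym (-1)) * φ (sym (-1)))) = -2 * (ξ * φ (sym (-1))) := by
      rw [← hEξ, hEqq]
      noncomm_ring
    have e₂ : φ (sym (-1)) * (φ (eta k) * (φ (sym (-1)) * φ (sym u))) =
        -2 * (φ (sym (-1)) * φ (sym u)) := by
      rw [← mul_assoc, ← (commute_eta_map φ _).eq, ← mul_assoc, mul_assoc (φ (eta k)), hEqq,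
        mul_assoc]
    rw [hXl, mul_assoc, hEξ, hME, hX, hξξ, hu, mul_add, mul_add, e₂]
    simp only [mul_add, e₁]
    noncomm_ring
  have p₆ : (chiOdd m : R) * (φ (eta k) * (ξ * φ (sym u))) * φ (sym (-u)) = 0 := by
    rw [mul_assoc, mul_assoc, mul_assoc, hcc, mul_zero, mul_zero, mul_zero]
  have p₇ : (chiOdd m : R) * (φ (eta k) * (ξ * φ (sym u))) * (φ (epsInt k m) * ξ) =
      (chiOdd m : R) * (φ (eta k) * (ξ * (φ (sym (-1)) * φ (sym u)))) := by
    rw [mul_assoc, mul_assoc, mul_assoc, hMc, hMξ, eta_mul_epsInt_mul, hX, ← hEξ,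
      h.eta_sym_comm, hEξ, hξξ]
  have p₈ : (chiOdd m : R) * (φ (eta k) * (ξ * φ (sym u))) *
      ((chiOdd m : R) * (φ (eta k) * (ξ * φ (sym (-u))))) = 0 := by
    rw [mul_assoc, mul_assoc, mul_assoc, p₂, mul_zero, mul_zero, mul_zero]
  simp only [ramifiedSym, mul_add, add_mul, p₁, p₂, p₃, p₄, p₅, p₆, p₇, p₈, hcc]
  noncomm_ring

omit h in
theorem ramifiedSym_zero (u : kˣ) : ramifiedSym φ ξ 0 u = φ (sym u) := by
  simp [ramifiedSym, epsInt_zero, chiOdd]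

omit h in
theorem ramifiedSym_one_one : ramifiedSym φ ξ 1 1 = ξ := by
  simp [ramifiedSym, epsInt_one, sym_one]

end IsUniformizing

/-- A genuine symbol is a formal uniformizer, so the identities above also compute `[a^m]` and `[a^m
b]` in `KMW k`. -/
theorem isUniformizing_sym (a : kˣ) : IsUniformizing (RingHom.id (KMW k)) (sym a) where
  eta_comm := sym_mul_eta a
  sym_comm u := sym_mul_sym_comm u a
  sq := sym_mul_self a

theorem sym_inv (a : kˣ) : sym a⁻¹ = eps k * sym a := by
  have h : angle (-1) * sym a = angle a * sym a := by
    simp only [angle, add_mul, mul_assoc]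
    rw [sym_mul_self, eta_mul_sym_mul_sym_comm]
  have h' := sym_mul' a a⁻¹
  rw [mul_inv_cancel, sym_one] at h'
  rw [eps, neg_mul, h, eq_neg_of_add_eq_zero_left h'.symm, mul_neg, neg_neg, ← mul_assoc, angle_mul_self, one_mul]

theorem sym_zpow (a : kˣ) (m : ℤ) : sym (a ^ m) = epsInt k m * sym a := by
  have h := (isUniformizing_sym a).epsInt_add_mul
  simp only [RingHom.id_apply] at h
  induction m using Int.induction_on with
  | zero => simp [epsInt_zero, sym_one]
  | succ m ih => rw [zpow_add_one, sym_mul, ih, h m 1, epsInt_one, one_mul]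
  | pred m ih =>
    rw [zpow_sub_one, sym_mul, ih, sub_eq_add_neg, h (-m) (-1), epsInt_neg_one, sym_inv]

theorem sym_zpow_mul (a b : kˣ) (m : ℤ) :
    sym (a ^ m * b) = ramifiedSym (RingHom.id (KMW k)) (sym a) m b := by
  rw [IsUniformizing.ramifiedSym_eq, sym_mul, sym_zpow]
  rfl

end Uniformizing

/-! ### Units, uniformizers and the Steinberg relation over a discrete valuation. -/

section Uniformizer

variable {F : Type*} [Field F] {v : Valuation F ℤᵐ⁰}

theorem inclUnit_injective : Function.Injective (inclUnit v) :=
  Units.map_injective Subtype.val_injective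

theorem coe_inclUnit (u : v.valuationSubringˣ) : (inclUnit v u : F) = (u : v.valuationSubring) :=
  rfl

theorem coe_redUnit (u : v.valuationSubringˣ) :
    (redUnit v u : ResField v) = IsLocalRing.residue _ (u : v.valuationSubring) :=
  rfl

theorem valuation_inclUnit (u : v.valuationSubringˣ) : v (inclUnit v u) = 1 := by
  have h (u : v.valuationSubringˣ) : v (inclUnit v u) ≤ 1 :=
    (Valuation.mem_valuationSubring_iff _ _).mp (u : v.valuationSubring).2
  refine le_antisymm (h u) ?_
  have h₁ : v (inclUnit v u) * v (inclUnit v u⁻¹) = 1 := by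
    rw [← map_mul, ← Units.val_mul, ← map_mul, mul_inv_cancel, map_one, Units.val_one, map_one]
  rw [← h₁]
  exact mul_le_of_le_one_right' (h _)

theorem exists_inclUnit_eq {a : Fˣ} (ha : v a = 1) : ∃ u, inclUnit v u = a := by
  have h₁ : (a : F) ∈ v.valuationSubring := (Valuation.mem_valuationSubring_iff _ _).mpr ha.le
  have h₂ : ((a⁻¹ : Fˣ) : F) ∈ v.valuationSubring :=
    (Valuation.mem_valuationSubring_iff _ _).mpr (by rw [Units.val_inv_eq_inv_val, map_inv₀, ha,
      inv_one])
  exact ⟨⟨⟨a, h₁⟩, ⟨_, h₂⟩, Subtype.ext (by simp), Subtype.ext (by simp)⟩, Units.ext rfl⟩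

variable [v.IsRankOneDiscrete] {π : Fˣ} (hπ : v.IsUniformizer (π : F))
include hπ

theorem exists_eq_zpow_mul (a : Fˣ) : ∃ (m : ℤ) (u : v.valuationSubringˣ),
    a = π ^ m * inclUnit v u := by
  have h : v a ∈ Set.range v \ {0} := ⟨⟨a, rfl⟩, by simp⟩
  -- The value group is cyclic and generated by the value of `π`, so dividing by a power of `π`
  -- leaves an element of value `1`.
  rw [← Valuation.IsRankOneDiscrete.generator_zpowers_eq_range] at h
  obtain ⟨γ, ⟨m, rfl⟩, hm⟩ := h
  obtain ⟨u, hu⟩ : ∃ u, inclUnit v u = (π ^ m)⁻¹ * a := by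
    refine exists_inclUnit_eq ?_
    rw [Units.val_mul, map_mul, ← hm, Units.val_inv_eq_inv_val, map_inv₀, Units.val_zpow_eq_zpow_val,
      map_zpow₀, hπ.val]
    push_cast
    exact inv_mul_cancel₀ (zpow_ne_zero _ (Units.ne_zero _))
  exact ⟨m, u, by rw [hu, mul_inv_cancel_left]⟩

theorem valuation_zpow_lt_one {m : ℤ} (hm : 0 < m) : v ((π ^ m : Fˣ) : F) < 1 := by
  obtain ⟨n, rfl⟩ := Int.eq_ofNat_of_zero_le hm.le
  rw [zpow_natCast, Units.val_pow_eq_pow_val, map_pow]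
  exact pow_lt_one₀ zero_le hπ.val_lt_one (by omega)

theorem zpow_mul_inclUnit_inj {m n : ℤ} {u w : v.valuationSubringˣ}
    (h : π ^ m * inclUnit v u = π ^ n * inclUnit v w) : m = n ∧ u = w := by
  have key {m n : ℤ} {u w : v.valuationSubringˣ}
      (h : π ^ m * inclUnit v u = π ^ n * inclUnit v w) : ¬ m < n := fun hmn => by
    have h₁ : inclUnit v u = π ^ (n - m) * inclUnit v w := by
      rw [sub_eq_neg_add, zpow_add, mul_assoc, ← h, zpow_neg, inv_mul_cancel_left]
    have h₂ := valuation_zpow_lt_one hπ (sub_pos.mpr hmn)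
    have h₃ := congrArg (fun x : Fˣ => v x) h₁
    simp only [Units.val_mul, map_mul, valuation_inclUnit, mul_one] at h₃
    exact h₂.ne h₃.symm
  have hmn : m = n := le_antisymm (not_lt.mp (key h.symm)) (not_lt.mp (key h))
  subst hmn
  exact ⟨rfl, inclUnit_injective (mul_left_cancel h)⟩

theorem exists_inclUnit_eq_one_sub {m : ℤ} (hm : 0 < m) (u : v.valuationSubringˣ) :
    ∃ w : v.valuationSubringˣ, (inclUnit v w : F) = 1 - (π ^ m * inclUnit v u : Fˣ) ∧
      redUnit v w = 1 := by
  have hlt : v ((π ^ m * inclUnit v u : Fˣ) : F) < 1 := by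
    rw [Units.val_mul, map_mul, valuation_inclUnit, mul_one]
    exact valuation_zpow_lt_one hπ hm
  let x : v.valuationSubring := ⟨_, (Valuation.mem_valuationSubring_iff _ _).mpr hlt.le⟩
  have hx : IsLocalRing.residue _ x = 0 := by
    rw [IsLocalRing.residue_eq_zero_iff, IsLocalRing.mem_maximalIdeal, mem_nonunits_iff]
    rintro ⟨w, hw⟩
    have := valuation_inclUnit w
    rw [coe_inclUnit, hw] at this
    exact hlt.ne this
  have h₁ : IsUnit (1 - x) := by
    rw [← IsLocalRing.residue_ne_zero_iff_isUnit, map_sub, hx, map_one, sub_zero]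
    exact one_ne_zero
  obtain ⟨w, hw⟩ := h₁
  refine ⟨w, ?_, Units.ext ?_⟩
  · rw [coe_inclUnit, hw]
    rfl
  · rw [coe_redUnit, hw, map_sub, hx, map_one, sub_zero, Units.val_one]

/-- If `a + b = 1` and `a` is in the maximal ideal, then `b` is a unit with reduction `1`. -/
theorem eq_zero_and_redUnit_eq_one {m n : ℤ} {u w : v.valuationSubringˣ} (hm : 0 < m)
    (h : ((π ^ m * inclUnit v u : Fˣ) : F) + (π ^ n * inclUnit v w : Fˣ) = 1) :
    n = 0 ∧ redUnit v w = 1 := by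
  obtain ⟨w', hw', h₁⟩ := exists_inclUnit_eq_one_sub hπ hm u
  have h₂ : π ^ n * inclUnit v w = π ^ (0 : ℤ) * inclUnit v w' := by
    rw [zpow_zero, one_mul]
    refine Units.ext ?_
    rw [hw', ← h, add_sub_cancel_left]
  obtain ⟨h₃, rfl⟩ := zpow_mul_inclUnit_inj hπ h₂
  exact ⟨h₃, h₁⟩

/-- If `a + b = 1` and `a` is not integral, then `b` has the same valuation as `a` and its
leading coefficient is opposite to that of `a`. -/
theorem eq_and_redUnit_eq_neg {m n : ℤ} {u w : v.valuationSubringˣ} (hm : m < 0)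
    (h : ((π ^ m * inclUnit v u : Fˣ) : F) + (π ^ n * inclUnit v w : Fˣ) = 1) :
    n = m ∧ redUnit v w = - redUnit v u := by
  -- For `a = π^m u` the inverse lies in the maximal ideal, and `1 - a = -a(1 - a⁻¹)` with `1 - a⁻¹`
  -- a unit of reduction `1`.
  obtain ⟨w', hw', h₁⟩ := exists_inclUnit_eq_one_sub hπ (neg_pos.mpr hm) u⁻¹
  have h₀ : inclUnit v (-u) = - inclUnit v u := Units.ext (by simp [coe_inclUnit])
  have h₂ : π ^ n * inclUnit v w = π ^ m * inclUnit v (-u * w') := by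
    refine Units.ext ?_
    rw [map_mul, h₀, ← mul_assoc, Units.val_mul _ (inclUnit v w'), hw', zpow_neg, map_inv,
      ← mul_inv, mul_neg, Units.val_neg, mul_sub, mul_one, neg_mul, ← Units.val_mul,
      mul_inv_cancel, Units.val_one, ← h]
    ring
  obtain ⟨h₃, rfl⟩ := zpow_mul_inclUnit_inj hπ h₂
  refine ⟨h₃, ?_⟩
  rw [map_mul, h₁, mul_one]
  exact Units.ext (by simp [coe_redUnit])

omit [v.IsRankOneDiscrete] hπ in
theorem redUnit_add_redUnit {u w : v.valuationSubringˣ}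
    (h : (inclUnit v u : F) + inclUnit v w = 1) :
    (redUnit v u : ResField v) + redUnit v w = 1 := by
  rw [coe_redUnit, coe_redUnit, ← map_add, ← map_one (IsLocalRing.residue _)]
  exact congrArg _ (Subtype.ext h)

/-- The extension of `φ` and `ξ` to a morphism from Milnor-Witt K-theory that maps
the symbol `[π ^ m u]` to `[ū] + m_ε ξ + χ(m) η ξ [ū]`. -/
theorem exists_hom_of_isUniformizing {R : Type*} [Ring R] {φ : KMW (ResField v) →+* R} {ξ : R}
    (h : IsUniformizing φ ξ) : ∃ Θ : KMW F →+* R,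
      Θ (eta F) = φ (eta (ResField v)) ∧ ∀ (m : ℤ) (u : v.valuationSubringˣ),
        Θ (sym (π ^ m * inclUnit v u)) = ramifiedSym φ ξ m (redUnit v u) := by
  choose m u hmu using exists_eq_zpow_mul (v := v) hπ
  let s (a : Fˣ) : R := ramifiedSym φ ξ (m a) (redUnit v (u a))
  have hs (n : ℤ) (w : v.valuationSubringˣ) :
      s (π ^ n * inclUnit v w) = ramifiedSym φ ξ n (redUnit v w) := by
    obtain ⟨h₁, h₂⟩ := zpow_mul_inclUnit_inj hπ (hmu (π ^ n * inclUnit v w))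
    show ramifiedSym _ _ _ _ = _
    rw [← h₁, ← h₂]
  have h₁ (a b : Fˣ) (hab : (a : F) + b = 1) : s a * s b = 0 := by
    rw [hmu a, hmu b] at hab
    have hba := (add_comm _ _).trans hab
    simp only [s]
    -- Negative valuation: opposite leading terms. Zero: either both are units, or `a` reduces to
    -- `1`. Positive: `b` reduces to `1`.
    rcases lt_trichotomy (m a) 0 with ha | ha | ha
    · obtain ⟨h₁, h₂⟩ := eq_and_redUnit_eq_neg hπ ha hab
      rw [h₁, h₂, h.ramifiedSym_mul_neg]
    · rcases lt_trichotomy (m b) 0 with hb | hb | hb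
      · have := (eq_and_redUnit_eq_neg hπ hb hba).1
        omega
      · rw [ha, hb, IsUniformizing.ramifiedSym_zero, IsUniformizing.ramifiedSym_zero, ← map_mul,
          sym_mul_sym_of_add_eq_one, map_zero]
        refine redUnit_add_redUnit ?_
        rwa [ha, hb, zpow_zero, one_mul, one_mul] at hab
      · rw [(eq_zero_and_redUnit_eq_one hπ hb hba).2, ha, IsUniformizing.ramifiedSym_zero, sym_one,
          map_zero, zero_mul]
    · obtain ⟨h₁, h₂⟩ := eq_zero_and_redUnit_eq_one hπ ha hab
      rw [h₁, h₂, IsUniformizing.ramifiedSym_zero, sym_one, map_zero, mul_zero]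
  have h₂ (a b : Fˣ) : s (a * b) = s a + s b + φ (eta _) * (s a * s b) := by
    have hab : a * b = π ^ (m a + m b) * inclUnit v (u a * u b) := by
      conv_lhs => rw [hmu a, hmu b]
      rw [zpow_add, map_mul, mul_mul_mul_comm]
    rw [hab, hs, map_mul, h.ramifiedSym_mul]
  have h₄ : φ (eta _) * (φ (eta _) * s (-1) + 2) = 0 := by
    have h₀ : (-1 : Fˣ) = π ^ (0 : ℤ) * inclUnit v (-1) := by
      rw [zpow_zero, one_mul]
      exact Units.ext (by simp [coe_inclUnit])
    have h₀' : redUnit v (-1) = -1 := Units.ext (by simp [coe_redUnit])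
    rw [h₀, hs, IsUniformizing.ramifiedSym_zero, h₀', ← map_ofNat φ, ← map_mul, ← map_add,
      ← map_mul, eta_mul_hyperbolic, map_zero]
  refine ⟨KMW.lift s (φ (eta _)) h₁ h₂ (fun a => h.ramifiedSym_comm_eta _ _) h₄,
    KMW.lift_eta _ _ _ _, fun n w => ?_⟩
  rw [KMW.lift_sym, hs]

end Uniformizer

/-! ### The grading of Milnor–Witt K-theory. -/

section Grading

variable {F : Type*} [Field F]

theorem word_mem_component (w : List (Gen F)) :
    (w.map gen).prod ∈ component F (w.map Gen.deg).sum :=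
  AddSubgroup.subset_closure ⟨w, rfl, rfl⟩

theorem mul_mem_component {m n r : ℤ} (h : m + n = r) {x y : KMW F} (hx : x ∈ component F m)
    (hy : y ∈ component F n) : x * y ∈ component F r := by
  subst h
  induction hx using AddSubgroup.closure_induction with
  | mem x hx =>
    obtain ⟨w, rfl, rfl⟩ := hx
    induction hy using AddSubgroup.closure_induction with
    | mem y hy =>
      obtain ⟨w', rfl, rfl⟩ := hy
      rw [← List.prod_append, ← List.sum_append, ← List.map_append, ← List.map_append]
      exact word_mem_component _
    | zero => rw [mul_zero]; exact zero_mem _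
    | add y z _ _ h₁ h₂ => rw [mul_add]; exact add_mem h₁ h₂
    | neg y _ h => rw [mul_neg]; exact neg_mem h
  | zero => rw [zero_mul]; exact zero_mem _
  | add x z _ _ h₁ h₂ => rw [add_mul]; exact add_mem h₁ h₂
  | neg x _ h => rw [neg_mul]; exact neg_mem h

theorem one_mem_component : (1 : KMW F) ∈ component F 0 := word_mem_component []

theorem intCast_mem_component (m : ℤ) : (m : KMW F) ∈ component F 0 := by
  rw [← zsmul_one]
  exact zsmul_mem one_mem_component m

theorem sym_mem_component (a : Fˣ) : sym a ∈ component F 1 := by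
  simpa [Gen.deg, sym] using word_mem_component [Gen.sym a]

theorem eta_mem_component : eta F ∈ component F (-1) := by
  simpa [Gen.deg, eta] using word_mem_component [(Gen.eta : Gen F)]

theorem eta_mul_sym_mem_component (a : Fˣ) : eta F * sym a ∈ component F 0 :=
  mul_mem_component (by norm_num) eta_mem_component (sym_mem_component a)

theorem epsInt_mem_component (m : ℤ) : epsInt F m ∈ component F 0 := by
  rw [epsInt_eq]
  exact add_mem (intCast_mem_component _)
    (mul_mem_component (zero_add 0) (intCast_mem_component _) (eta_mul_sym_mem_component _))

theorem eps_mem_component : eps F ∈ component F 0 := by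
  rw [← epsInt_neg_one]
  exact epsInt_mem_component _

end Grading

theorem eta_mul_eps_mul {F : Type*} [Field F] (x : KMW F) : eta F * (eps F * x) = eta F * x := by
  rw [← mul_assoc, mul_eps, eps_mul_eta]

/-! ### The ramified quadratic extension as a ring of matrices. -/

section Ramified

variable (k : Type*) [Field k]

/-- The endomorphism of Milnor-Witt K-theory that multiplies elements of degree `n` by `ε ^ n`. -/
def epsTwist : KMW k →+* KMW k :=
  KMW.lift (fun a => eps k * sym a) (eta k)
    (fun a b h => by
      rw [mul_assoc, ← mul_assoc (sym a), mul_eps, mul_assoc, sym_mul_sym_of_add_eq_one h,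
        mul_zero, mul_zero])
    (fun a b => by
      rw [mul_assoc (eps k) (sym a), eta_mul_eps_mul, ← mul_assoc (sym a), mul_eps, mul_assoc,
        eta_mul_eps_mul, sym_mul, mul_add, mul_add, ← mul_assoc (eps k) (eta k), eps_mul_eta])
    (fun a => by rw [mul_eta])
    (by rw [eps_mul_sym_neg_one, eta_mul_hyperbolic])

variable {k}

theorem epsTwist_sym (a : kˣ) : epsTwist k (sym a) = eps k * sym a := KMW.lift_sym _ _ _ _ a

theorem epsTwist_eta : epsTwist k (eta k) = eta k := KMW.lift_eta _ _ _ _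

theorem epsTwist_sym_neg_one : epsTwist k (sym (-1)) = sym (-1) := by
  rw [epsTwist_sym, eps_mul_sym_neg_one]

theorem epsTwist_epsInt (m : ℤ) : epsTwist k (epsInt k m) = epsInt k m := by
  rw [epsInt_eq]
  simp [epsTwist_sym_neg_one, epsTwist_eta]

theorem epsTwist_eps : epsTwist k (eps k) = eps k := by
  rw [← epsInt_neg_one, epsTwist_epsInt]

variable (k)

/-- The left multiplication of Milnor-Witt K-theory on its free ramified quadratic extension
with basis `1`, `ξ`, where `ξ ^ 2 = ξ [-1]` and `ξ` `ε`-commutes with symbols. -/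
def ramifiedScalar : KMW k →+* Matrix (Fin 2) (Fin 2) (KMW k) :=
  (Matrix.diagonalRingHom (Fin 2) (KMW k)).comp
    (RingHom.pi fun i => if i = 0 then RingHom.id _ else epsTwist k)

/-- The left multiplication by `ξ` on the ramified quadratic extension. -/
def ramifiedRoot : Matrix (Fin 2) (Fin 2) (KMW k) := !![0, 0; 1, sym (-1)]

variable {k}

theorem ramifiedScalar_apply (x : KMW k) : ramifiedScalar k x = !![x, 0; 0, epsTwist k x] := by
  ext i j
  fin_cases i <;> fin_cases j <;> simp [ramifiedScalar]

/-- The matrices describe left multiplication on the right module with basis `1, ξ`: moving `ξ` to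
the left of a coefficient applies `epsTwist`, and `ξ` sends `1` to `ξ` and `ξ` to `ξ[-1]`. -/
theorem isUniformizing_ramifiedRoot : IsUniformizing (ramifiedScalar k) (ramifiedRoot k) where
  eta_comm := by
    rw [ramifiedScalar_apply, ramifiedRoot, Matrix.mul_fin_two, Matrix.mul_fin_two]
    simp [epsTwist_eta, mul_eta]
  sym_comm u := by
    have h : eps k * sym u * sym (-1) = eps k * (sym (-1) * (eps k * sym u)) := by
      rw [mul_assoc, sym_mul_sym_comm u, ← mul_assoc (sym (-1)), mul_eps, mul_assoc]
    simp only [ramifiedScalar_apply, ramifiedRoot, Matrix.mul_fin_two]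
    simp [epsTwist_eps, epsTwist_sym, h]
  sq := by
    simp only [ramifiedScalar_apply, ramifiedRoot, Matrix.mul_fin_two]
    simp [epsTwist_sym_neg_one]

variable (k)

/-- The homogeneous component of degree `n` of the ramified quadratic extension. -/
def ramifiedComponent (n : ℤ) : AddSubgroup (Matrix (Fin 2) (Fin 2) (KMW k)) where
  carrier := {M | M 0 0 ∈ component k n ∧ M 0 1 = 0 ∧ M 1 0 ∈ component k (n - 1) ∧
    M 1 1 ∈ component k n}
  add_mem' := by
    rintro M N ⟨h₁, h₂, h₃, h₄⟩ ⟨h₁', h₂', h₃', h₄'⟩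
    exact ⟨add_mem h₁ h₁', by simp [h₂, h₂'], add_mem h₃ h₃', add_mem h₄ h₄'⟩
  zero_mem' := ⟨zero_mem _, rfl, zero_mem _, zero_mem _⟩
  neg_mem' := by
    rintro M ⟨h₁, h₂, h₃, h₄⟩
    exact ⟨neg_mem h₁, by simp [h₂], neg_mem h₃, neg_mem h₄⟩

variable {k}

/-- As `ξ` has degree `1`, its coefficient sits one degree lower; this is why the residue lowers
degrees by one. -/
theorem mul_mem_ramifiedComponent {m n r : ℤ} (h : m + n = r)
    {M N : Matrix (Fin 2) (Fin 2) (KMW k)} (hM : M ∈ ramifiedComponent k m)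
    (hN : N ∈ ramifiedComponent k n) : M * N ∈ ramifiedComponent k r := by
  obtain ⟨h₁, h₂, h₃, h₄⟩ := hM
  obtain ⟨h₁', h₂', h₃', h₄'⟩ := hN
  have e (i j : Fin 2) : (M * N) i j = M i 0 * N 0 j + M i 1 * N 1 j := by
    rw [Matrix.mul_apply, Fin.sum_univ_two]
  refine ⟨?_, ?_, ?_, ?_⟩
  · rw [e, h₂, zero_mul, add_zero]
    exact mul_mem_component h h₁ h₁'
  · rw [e, h₂, h₂', zero_mul, mul_zero, add_zero]
  · rw [e]
    exact add_mem (mul_mem_component (by omega) h₃ h₁') (mul_mem_component (by omega) h₄ h₃')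
  · rw [e, h₂', mul_zero, zero_add]
    exact mul_mem_component h h₄ h₄'

theorem ramifiedScalar_mem {n : ℤ} {x : KMW k} (hx : x ∈ component k n)
    (hx' : epsTwist k x ∈ component k n) : ramifiedScalar k x ∈ ramifiedComponent k n := by
  rw [ramifiedScalar_apply]
  exact ⟨hx, rfl, zero_mem _, hx'⟩

theorem ramifiedScalar_eta_mem : ramifiedScalar k (eta k) ∈ ramifiedComponent k (-1) :=
  ramifiedScalar_mem eta_mem_component (by rw [epsTwist_eta]; exact eta_mem_component)

theorem ramifiedSym_mem (m : ℤ) (u : kˣ) :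
    ramifiedSym (ramifiedScalar k) (ramifiedRoot k) m u ∈ ramifiedComponent k 1 := by
  have hu : ramifiedScalar k (sym u) ∈ ramifiedComponent k 1 :=
    ramifiedScalar_mem (sym_mem_component u) (by
      rw [epsTwist_sym]; exact mul_mem_component (zero_add 1) eps_mem_component (sym_mem_component u))
  have hξ : ramifiedRoot k ∈ ramifiedComponent k 1 :=
    ⟨zero_mem _, rfl, one_mem_component, sym_mem_component _⟩
  have hm : ramifiedScalar k (epsInt k m) ∈ ramifiedComponent k 0 :=
    ramifiedScalar_mem (epsInt_mem_component m) (by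
      rw [epsTwist_epsInt]; exact epsInt_mem_component m)
  refine add_mem (add_mem hu (mul_mem_ramifiedComponent (zero_add 1) hm hξ)) ?_
  rw [← zsmul_eq_mul]
  exact zsmul_mem (mul_mem_ramifiedComponent (by norm_num) ramifiedScalar_eta_mem
    (mul_mem_ramifiedComponent one_add_one_eq_two hξ hu)) _

end Ramified

/-! ### Existence of the residue morphism. -/

section Residue

variable {F : Type*} [Field F] {v : Valuation F ℤᵐ⁰} [v.IsRankOneDiscrete]
  {π : Fˣ} (hπ : v.IsUniformizer (π : F))
include hπ

theorem exists_isResidue : ∃ d : KMW F →+ KMW (ResField v), IsResidue v π d := by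
  obtain ⟨Θ, hη, hΘ⟩ := exists_hom_of_isUniformizing hπ
    (isUniformizing_ramifiedRoot (k := ResField v))
  have hu (us : List v.valuationSubringˣ) : Θ (symbol (us.map (inclUnit v))) =
      ramifiedScalar _ (symbol (us.map (redUnit v))) := by
    simp only [symbol, map_list_prod, List.map_map]
    congr 2
    funext u
    have := hΘ 0 u
    rwa [zpow_zero, one_mul, IsUniformizing.ramifiedSym_zero] at this
  have hξ : Θ (sym π) = ramifiedRoot _ := by
    have := hΘ 1 1
    rwa [zpow_one, map_one, map_one, mul_one, IsUniformizing.ramifiedSym_one_one] at this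
  have hmem (n : ℤ) (x : KMW F) (hx : x ∈ component F n) : Θ x ∈ ramifiedComponent _ n := by
    induction hx using AddSubgroup.closure_induction with
    | mem x hx =>
      obtain ⟨w, rfl, rfl⟩ := hx
      induction w with
      | nil =>
        rw [List.map_nil, List.map_nil, List.prod_nil, map_one, ← map_one (ramifiedScalar _)]
        exact ramifiedScalar_mem one_mem_component (by rw [map_one]; exact one_mem_component)
      | cons g w ih =>
        rw [List.map_cons, List.map_cons, List.prod_cons, map_mul, List.sum_cons]
        refine mul_mem_ramifiedComponent rfl ?_ ih
        cases g with
        | sym a =>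
          obtain ⟨m, u, rfl⟩ := exists_eq_zpow_mul (v := v) hπ a
          have := hΘ m u
          exact this ▸ ramifiedSym_mem m (redUnit v u)
        | eta => exact hη ▸ ramifiedScalar_eta_mem
    | zero => rw [map_zero]; exact zero_mem _
    | add x y _ _ h₁ h₂ => rw [map_add]; exact add_mem h₁ h₂
    | neg x _ h => rw [map_neg]; exact neg_mem h
  -- The `(1,0)` entry is the coefficient of `ξ` in the image of the basis vector `1`.
  refine ⟨AddMonoidHom.mk' (fun x => Θ x 1 0) fun x y => by rw [map_add, Matrix.add_apply], ?_, ?_, ?_, ?_⟩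
  · exact fun n x hx => (hmem n x hx).2.2.1
  · intro x
    simp [hη, ramifiedScalar_apply, Matrix.mul_apply, epsTwist_eta]
  · intro us
    have : symbol (π :: us.map (inclUnit v)) = sym π * symbol (us.map (inclUnit v)) := rfl
    simp [this, hu, hξ, ramifiedScalar_apply, ramifiedRoot]
  · intro us
    simp [hu, ramifiedScalar_apply]

end Residue

/-! ### Additive generators, and uniqueness of the residue morphism. -/

section Uniqueness

variable {F : Type*} [Field F] {v : Valuation F ℤᵐ⁰}

theorem inclUnit_neg_one : inclUnit v (-1) = -1 := Units.ext (by simp [coe_inclUnit])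

theorem redUnit_neg_one : redUnit v (-1) = -1 := Units.ext (by simp [coe_redUnit])

theorem symbol_cons {k : Type*} [Field k] (a : kˣ) (l : List kˣ) :
    symbol (a :: l) = sym a * symbol l := by
  simp [symbol]

theorem mul_eta_pow_mul {k : Type*} [Field k] (x y : KMW k) (i : ℕ) :
    x * (eta k ^ i * y) = eta k ^ i * (x * y) := by
  rw [← mul_assoc, ← ((commute_eta x).pow_left i).eq, mul_assoc]

variable (v)

/-- The additive subgroup generated by the elements `η ^ i [u₁, …, uₙ]` and
`η ^ i [π, u₁, …, uₙ]`. -/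
def unitSpan (π : Fˣ) : AddSubgroup (KMW F) :=
  AddSubgroup.closure {x | ∃ (i : ℕ) (us : List v.valuationSubringˣ),
    x = eta F ^ i * symbol (us.map (inclUnit v)) ∨
      x = eta F ^ i * symbol (π :: us.map (inclUnit v))}

variable {v} {π : Fˣ}

theorem eta_pow_mul_symbol_mem_unitSpan (i : ℕ) (us : List v.valuationSubringˣ) :
    eta F ^ i * symbol (us.map (inclUnit v)) ∈ unitSpan v π :=
  AddSubgroup.subset_closure ⟨i, us, Or.inl rfl⟩

theorem eta_pow_mul_symbol_cons_mem_unitSpan (i : ℕ) (us : List v.valuationSubringˣ) :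
    eta F ^ i * symbol (π :: us.map (inclUnit v)) ∈ unitSpan v π :=
  AddSubgroup.subset_closure ⟨i, us, Or.inr rfl⟩

theorem mul_mem_unitSpan_of_generators (y : KMW F)
    (h₁ : ∀ (i : ℕ) (us : List v.valuationSubringˣ),
      y * (eta F ^ i * symbol (us.map (inclUnit v))) ∈ unitSpan v π)
    (h₂ : ∀ (i : ℕ) (us : List v.valuationSubringˣ),
      y * (eta F ^ i * symbol (π :: us.map (inclUnit v))) ∈ unitSpan v π)
    {x : KMW F} (hx : x ∈ unitSpan v π) : y * x ∈ unitSpan v π := by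
  induction hx using AddSubgroup.closure_induction with
  | mem x hx =>
    obtain ⟨i, us, rfl | rfl⟩ := hx
    exacts [h₁ i us, h₂ i us]
  | zero => rw [mul_zero]; exact zero_mem _
  | add x z _ _ h₁ h₂ => rw [mul_add]; exact add_mem h₁ h₂
  | neg x _ h => rw [mul_neg]; exact neg_mem h

theorem eta_mul_mem_unitSpan {x : KMW F} (hx : x ∈ unitSpan v π) :
    eta F * x ∈ unitSpan v π := by
  refine mul_mem_unitSpan_of_generators _ (fun i us => ?_) (fun i us => ?_) hx
  · rw [← mul_assoc, ← pow_succ']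
    exact eta_pow_mul_symbol_mem_unitSpan _ _
  · rw [← mul_assoc, ← pow_succ']
    exact eta_pow_mul_symbol_cons_mem_unitSpan _ _

theorem sym_inclUnit_mul_mem_unitSpan (u : v.valuationSubringˣ) {x : KMW F}
    (hx : x ∈ unitSpan v π) : sym (inclUnit v u) * x ∈ unitSpan v π := by
  refine mul_mem_unitSpan_of_generators _ (fun i us => ?_) (fun i us => ?_) hx
  · rw [mul_eta_pow_mul, ← symbol_cons, ← List.map_cons]
    exact eta_pow_mul_symbol_mem_unitSpan _ _
  -- This is ε-commutativity `[u][π] = ε[π][u]` with `ε = -1 - η[-1]` written out, so that `π` stays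
  -- in front.
  · have h : sym (inclUnit v u) * symbol (π :: us.map (inclUnit v)) =
        -symbol (π :: (u :: us).map (inclUnit v)) -
          eta F * symbol (π :: (-1 :: u :: us).map (inclUnit v)) := by
      simp only [List.map_cons, symbol_cons, inclUnit_neg_one]
      rw [← mul_assoc, sym_mul_sym_comm, eps, angle, ← mul_assoc (sym π) (sym (-1)),
        ← mul_assoc (eta F) (_ * _), ← eta_mul_sym_mul_sym_comm (-1) π]
      noncomm_ring
    rw [mul_eta_pow_mul, h, mul_sub, mul_neg, ← mul_assoc _ (eta F), ← pow_succ]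
    exact sub_mem (neg_mem (eta_pow_mul_symbol_cons_mem_unitSpan _ _))
      (eta_pow_mul_symbol_cons_mem_unitSpan _ _)

theorem sym_uniformizer_mul_mem_unitSpan {x : KMW F} (hx : x ∈ unitSpan v π) :
    sym π * x ∈ unitSpan v π := by
  refine mul_mem_unitSpan_of_generators _ (fun i us => ?_) (fun i us => ?_) hx
  · rw [mul_eta_pow_mul, ← symbol_cons]
    exact eta_pow_mul_symbol_cons_mem_unitSpan _ _
  · have h : sym π * symbol (π :: us.map (inclUnit v)) =
        symbol (π :: (-1 :: us).map (inclUnit v)) := by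
      rw [List.map_cons, symbol_cons, symbol_cons, symbol_cons, ← mul_assoc, sym_mul_self,
        inclUnit_neg_one, mul_assoc]
    rw [mul_eta_pow_mul, h]
    exact eta_pow_mul_symbol_cons_mem_unitSpan _ _

theorem intCast_mul_mem {R : Type*} [Ring R] (S : AddSubgroup R) (m : ℤ) {x : R} (hx : x ∈ S) :
    (m : R) * x ∈ S := by
  rw [← zsmul_eq_mul]
  exact zsmul_mem hx m

theorem sym_mul_mem_unitSpan [v.IsRankOneDiscrete] (hπ : v.IsUniformizer (π : F)) (a : Fˣ)
    {x : KMW F} (hx : x ∈ unitSpan v π) : sym a * x ∈ unitSpan v π := by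
  obtain ⟨m, u, rfl⟩ := exists_eq_zpow_mul (v := v) hπ a
  have h₁ := sym_inclUnit_mul_mem_unitSpan u hx
  have h₂ := sym_uniformizer_mul_mem_unitSpan hx
  have h₃ := sym_inclUnit_mul_mem_unitSpan (-1) h₂
  rw [inclUnit_neg_one] at h₃
  rw [sym_zpow_mul, ramifiedSym, RingHom.id_apply, RingHom.id_apply, RingHom.id_apply, add_mul,
    add_mul, epsInt_eq, add_mul, add_mul]
  simp only [mul_assoc]
  exact add_mem (add_mem h₁ (add_mem (intCast_mul_mem _ _ h₂)
      (intCast_mul_mem _ _ (eta_mul_mem_unitSpan h₃))))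
    (intCast_mul_mem _ _ (eta_mul_mem_unitSpan (sym_uniformizer_mul_mem_unitSpan h₁)))

/-- The span contains `1` and is stable under left multiplication by every generator, hence by every
element. -/
theorem mem_unitSpan [v.IsRankOneDiscrete] (hπ : v.IsUniformizer (π : F)) (x : KMW F) :
    x ∈ unitSpan v π := by
  suffices h : ∀ y ∈ unitSpan v π, x * y ∈ unitSpan v π by
    have h₁ : (1 : KMW F) ∈ unitSpan v π := by
      simpa [symbol] using eta_pow_mul_symbol_mem_unitSpan (π := π) (v := v) 0 []
    simpa using h 1 h₁
  induction x using KMW.induction with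
  | int n => exact fun y hy => intCast_mul_mem _ _ hy
  | sym a => exact fun y hy => sym_mul_mem_unitSpan hπ a hy
  | eta => exact fun y hy => eta_mul_mem_unitSpan hy
  | add x z hx hz => exact fun y hy => by rw [add_mul]; exact add_mem (hx y hy) (hz y hy)
  | mul x z hx hz => exact fun y hy => by rw [mul_assoc]; exact hx _ (hz y hy)

theorem IsResidue.map_eta_pow_mul {d : KMW F →+ KMW (ResField v)} (hd : IsResidue v π d) (i : ℕ)
    (x : KMW F) : d (eta F ^ i * x) = eta (ResField v) ^ i * d x := by
  induction i with
  | zero => simp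
  | succ i ih => rw [pow_succ', mul_assoc, hd.map_eta_mul, ih, pow_succ', mul_assoc]

theorem IsResidue.unique [v.IsRankOneDiscrete] (hπ : v.IsUniformizer (π : F))
    {d d' : KMW F →+ KMW (ResField v)} (hd : IsResidue v π d) (hd' : IsResidue v π d') :
    d = d' := by
  ext x
  have hx := mem_unitSpan hπ x
  induction hx using AddSubgroup.closure_induction with
  | mem x hx =>
    obtain ⟨i, us, rfl | rfl⟩ := hx
    · rw [hd.map_eta_pow_mul, hd'.map_eta_pow_mul, hd.map_units, hd'.map_units]
    · rw [hd.map_eta_pow_mul, hd'.map_eta_pow_mul, hd.map_uniformizer, hd'.map_uniformizer]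
  | zero => rw [map_zero, map_zero]
  | add x z _ _ h₁ h₂ => rw [map_add, map_add, h₁, h₂]
  | neg x _ h => rw [map_neg, map_neg, h]

end Uniqueness

/-! ### Collecting the powers of `[π]` in one term of the expansion. -/

section Expansion

open Polynomial

variable {F : Type*} [Field F]

theorem commute_sym_eta_mul_sym (a b : Fˣ) : Commute (sym a) (eta F * sym b) := by
  show _ * _ = _ * _
  rw [mul_eta_mul, eta_mul_sym_mul_sym_comm, mul_assoc]

theorem sym_mul_sym_pow (a b : Fˣ) (r : ℕ) : sym a * sym b ^ r = eps F ^ r * (sym b ^ r * sym a) := by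
  induction r with
  | zero => simp
  | succ r ih =>
    rw [pow_succ, ← mul_assoc, ih, mul_assoc, mul_assoc, sym_mul_sym_comm a b,
      ← mul_assoc (sym b ^ r) (eps F), mul_eps, mul_assoc, ← mul_assoc (eps F ^ r), ← pow_succ,
      ← mul_assoc (sym b ^ r)]

theorem commute_aeval {R : Type*} [Ring R] {x y : R} (h : Commute x y) (p : ℤ[X]) :
    Commute x (aeval y p) := by
  induction p using Polynomial.induction_on with
  | C a => simp
  | add p q hp hq => rw [map_add]; exact hp.add_right hq
  | monomial n a h' =>
    rw [map_mul, map_pow, aeval_X, aeval_C]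
    exact Commute.mul_right (by simp) (h.pow_right _)

/-- An index in `J` contributes `(1 + χ η[a])[c i]`, any other one `m_ε [a]`. The exponent of `ε`
counts the pairs of an index in `J` followed by one outside `J`, that is, the crossings. The factors
`1 + χ η[a]` are kept as a polynomial evaluated at `η[a]`, since they commute with one another and
with all symbols. -/
theorem prod_map_piecewise {ι : Type*} [LinearOrder ι] (a : Fˣ) (m : ι → ℤ) (c : ι → Fˣ)
    (J : Finset ι) (L : List ι) (hL : L.Pairwise (· < ·)) :
    (L.map (J.piecewise
      (fun i => sym (c i) + (chiOdd (m i) : KMW F) * (eta F * (sym a * sym (c i))))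
      (fun i => epsInt F (m i) * sym a))).prod =
    eps F ^ (L.map fun i => if i ∈ J then
        (L.map fun k => if k ∉ J ∧ i < k then 1 else 0).sum else 0).sum *
      (epsInt F (L.map fun k => if k ∈ J then 1 else m k).prod *
      (sym a ^ (L.map fun k => if k ∉ J then 1 else 0).sum *
      (aeval (eta F * sym a) (L.map fun i => if i ∈ J then 1 + C (chiOdd (m i)) * X else 1).prod *
      symbol ((L.filter (· ∈ J)).map c)))) := by
  induction L with
  | nil => simp [epsInt_one, symbol]
  | cons b L ih =>
    obtain ⟨hb, hL⟩ := List.pairwise_cons.mp hL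
    -- The new head precedes the whole tail, so it adds no crossing to the later indices.
    have h₁ : (L.map fun i => if i ∈ J then
        ((b :: L).map fun k => if k ∉ J ∧ i < k then 1 else 0).sum else 0) =
        L.map fun i => if i ∈ J then (L.map fun k => if k ∉ J ∧ i < k then 1 else 0).sum else 0 := by
      refine List.map_congr_left fun i hi => ?_
      simp [(hb i hi).not_gt]
    have h₂ : ((b :: L).map fun k => if k ∉ J ∧ b < k then 1 else 0).sum =
        (L.map fun k => if k ∉ J then 1 else 0).sum := by
      rw [List.map_cons, List.sum_cons, if_neg (by simp), zero_add]
      congr 1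
      refine List.map_congr_left fun k hk => ?_
      simp [hb k hk]
    rw [List.map_cons, List.prod_cons, ih hL, List.map_cons, List.sum_cons, h₁, h₂, List.map_cons,
      List.map_cons, List.map_cons, List.prod_cons, List.prod_cons, List.sum_cons]
    generalize (L.map fun i => if i ∈ J then _ else 0).sum = e
    generalize (L.map fun k => if k ∈ J then 1 else m k).prod = M
    generalize (L.map fun k => if k ∉ J then 1 else 0).sum = r
    generalize (L.map fun i => if i ∈ J then 1 + C (chiOdd (m i)) * X else 1).prod = p
    have hε (n : ℕ) (x y : KMW F) : x * (eps F ^ n * y) = eps F ^ n * (x * y) := by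
      rw [← mul_assoc, ← ((commute_eps x).pow_left n).eq, mul_assoc]
    have hM (x y : KMW F) : x * (epsInt F M * y) = epsInt F M * (x * y) := by
      rw [← mul_assoc, ← (commute_epsInt M x).eq, mul_assoc]
    by_cases hbJ : b ∈ J
    · rw [Finset.piecewise_eq_of_mem _ _ _ hbJ, if_pos hbJ, if_pos hbJ, if_neg (not_not.mpr hbJ),
        if_pos hbJ, List.filter_cons_of_pos (by simpa using hbJ), List.map_cons, symbol_cons,
        one_mul, zero_add, map_mul, hε, hM, add_comm r e, pow_add]
      have h₃ : sym (c b) + (chiOdd (m b) : KMW F) * (eta F * (sym a * sym (c b))) =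
          aeval (eta F * sym a) (1 + C (chiOdd (m b)) * X) * sym (c b) := by
        simp [add_mul, mul_assoc]
      have h₄ : ∀ q : ℤ[X], Commute (sym (c b)) (aeval (eta F * sym a) q) :=
        commute_aeval (commute_sym_eta_mul_sym _ _)
      have h₅ : ∀ q : ℤ[X], Commute (sym a ^ r) (aeval (eta F * sym a) q) := fun q =>
        (commute_aeval (commute_sym_eta_mul_sym _ _) q).pow_left r
      rw [h₃, mul_assoc _ (sym (c b)), ← mul_assoc (sym (c b)), sym_mul_sym_pow,
        mul_assoc (eps F ^ r), hε, mul_assoc (sym a ^ r), ← mul_assoc (aeval _ _) (sym a ^ r),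
        ← (h₅ _).eq, mul_assoc (sym a ^ r), ← mul_assoc (sym (c b)), (h₄ p).eq,
        mul_assoc, mul_assoc, ← hε r (epsInt F M), mul_assoc]
    · rw [Finset.piecewise_eq_of_notMem _ _ _ hbJ, if_neg hbJ, if_neg hbJ, if_pos hbJ, if_neg hbJ,
        List.filter_cons_of_neg (by simpa using hbJ), one_mul, zero_add, hε, mul_assoc, hM,
        epsInt_mul, add_comm, pow_succ']
      simp only [mul_assoc]

end Expansion

/-! ### Subsets as increasing sequences. -/

section OrderEmbedding

variable {n l : ℕ} (j : Fin l ↪o Fin n)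

include j in
theorem le_of_orderEmbedding : l ≤ n := by
  simpa using Fintype.card_le_of_injective j j.injective

theorem filter_finRange_eq_ofFn :
    (List.finRange n).filter (· ∈ Finset.univ.map j.toEmbedding) = List.ofFn j := by
  refine List.SortedLT.eq_of_mem_iff ?_ ?_ ?_
  · exact ((List.sortedLT_finRange n).pairwise.filter _).sortedLT
  · exact List.sortedLT_ofFn_iff.mpr j.strictMono
  · simp

theorem card_compl_orderEmbedding : (Finset.univ.map j.toEmbedding)ᶜ.card = n - l := by
  simp [Finset.card_compl]

/-- Of the `n - 1 - j i` indices above `j i`, exactly `l - 1 - i` belong to the image. In particular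
`j i ≤ n - l + i`, so the natural subtraction never truncates. -/
theorem card_filter_lt_orderEmbedding (i : Fin l) :
    (Finset.univ.filter fun k => k ∉ Finset.univ.map j.toEmbedding ∧ j i < k).card =
      n - l + ((i : ℕ) + 1) - ((j i : ℕ) + 1) := by
  have h₁ : (Finset.Ioi (j i)).filter (fun k => k ∉ Finset.univ.map j.toEmbedding) =
      Finset.univ.filter fun k => k ∉ Finset.univ.map j.toEmbedding ∧ j i < k := by
    ext k
    simp [and_comm]
  have h₂ : (Finset.Ioi (j i)).filter (fun k => k ∈ Finset.univ.map j.toEmbedding) =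
      (Finset.Ioi i).map j.toEmbedding := by
    ext k
    simp only [Finset.mem_filter, Finset.mem_Ioi, Finset.mem_map, Finset.mem_univ, true_and]
    constructor
    · rintro ⟨hk, i', rfl⟩
      exact ⟨i', j.lt_iff_lt.mp hk, rfl⟩
    · rintro ⟨i', hi', rfl⟩
      exact ⟨j.lt_iff_lt.mpr hi', i', rfl⟩
  have h₃ := Finset.card_filter_add_card_filter_not (s := Finset.Ioi (j i))
    (fun k => k ∈ Finset.univ.map j.toEmbedding)
  rw [h₁, h₂, Finset.card_map, Fin.card_Ioi, Fin.card_Ioi] at h₃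
  have := le_of_orderEmbedding j
  have := (j i).isLt
  have := i.isLt
  omega

theorem sum_finset_eq_sum_orderEmbedding {M : Type*} [AddCommMonoid M] (f : Finset (Fin n) → M) :
    ∑ J, f J = ∑ l ∈ Finset.range (n + 1), ∑ j : Fin l ↪o Fin n,
      f (Finset.univ.map j.toEmbedding) := by
  rw [← Finset.powerset_univ, Finset.sum_powerset, Finset.card_univ, Fintype.card_fin]
  refine Finset.sum_congr rfl fun l _ => (Finset.sum_bij (fun j _ => Finset.univ.map j.toEmbedding)
    ?_ ?_ ?_ fun _ _ => rfl).symm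
  · intro j _
    simp [Finset.mem_powersetCard]
  · intro j _ j' _ h
    have h₁ := filter_finRange_eq_ofFn j
    rw [h, filter_finRange_eq_ofFn] at h₁
    exact DFunLike.coe_injective (List.ofFn_injective h₁.symm)
  · intro J hJ
    obtain ⟨-, hJ⟩ := Finset.mem_powersetCard.mp hJ
    exact ⟨J.orderEmbOfFin hJ, Finset.mem_univ _, Finset.map_orderEmbOfFin_univ J hJ⟩

end OrderEmbedding

/-! ### Full expansion of a symbol in powers of `[π]`. -/

section Expansion

open Polynomial

variable {F : Type*} [Field F] {n : ℕ}

/-- The product is expanded in the commutative ring `ℤ[X]`, so `R` need not be commutative. -/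
theorem aeval_prod_one_add {l : ℕ} {R : Type*} [Ring R] (y : R) (χ : Fin l → ℤ) :
    aeval y (∏ i, (1 + C (χ i) * X)) =
      ∑ I : Finset (Fin l), ((∏ i ∈ I, χ i : ℤ) : R) * y ^ I.card := by
  rw [Finset.prod_one_add, Finset.powerset_univ, map_sum]
  refine Finset.sum_congr rfl fun I _ => ?_
  rw [Finset.prod_mul_distrib, Finset.prod_const, ← map_prod, map_mul, map_pow, aeval_X, aeval_C]
  simp

theorem prod_ofFn_piecewise {l : ℕ} (a : Fˣ) (m : Fin n → ℤ) (c : Fin n → Fˣ) (j : Fin l ↪o Fin n) :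
    (List.ofFn ((Finset.univ.map j.toEmbedding).piecewise
      (fun i => sym (c i) + (chiOdd (m i) : KMW F) * (eta F * (sym a * sym (c i))))
      (fun i => epsInt F (m i) * sym a))).prod =
    ∑ I : Finset (Fin l),
      epsInt F ((-1) ^ (∑ i : Fin l, (n - l + ((i : ℕ) + 1) - ((j i : ℕ) + 1))) *
        ∏ k ∈ (Finset.univ.map j.toEmbedding)ᶜ, m k) *
      ((chiOdd (∏ i ∈ I, m (j i)) : KMW F) * (eta F ^ I.card *
        (sym a ^ (n - l + I.card) * symbol (List.ofFn fun i => c (j i))))) := by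
  set J := Finset.univ.map j.toEmbedding with hJ
  have h₁ : ((List.finRange n).map fun i => if i ∈ J then
        ((List.finRange n).map fun k => if k ∉ J ∧ i < k then 1 else 0).sum else 0).sum =
      ∑ i : Fin l, (n - l + ((i : ℕ) + 1) - ((j i : ℕ) + 1)) := by
    rw [← Fin.sum_univ_def, ← Finset.sum_filter, Finset.filter_mem_eq_inter, Finset.univ_inter, hJ,
      Finset.sum_map]
    refine Finset.sum_congr rfl fun i _ => ?_
    rw [← Fin.sum_univ_def, ← Finset.card_filter]
    exact card_filter_lt_orderEmbedding j i
  have h₂ : ((List.finRange n).map fun k => if k ∈ J then 1 else m k).prod = ∏ k ∈ Jᶜ, m k := by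
    rw [← Fin.prod_univ_def, Finset.prod_ite, Finset.prod_const_one, one_mul]
    congr 1
    ext k
    simp
  have h₃ : ((List.finRange n).map fun k => if k ∉ J then 1 else 0).sum = n - l := by
    rw [← Fin.sum_univ_def, ← Finset.card_filter, ← card_compl_orderEmbedding j]
    congr 1
    ext k
    simp [hJ]
  have h₄ : ((List.finRange n).map fun i => if i ∈ J then
      1 + C (chiOdd (m i)) * X else (1 : ℤ[X])).prod = ∏ i : Fin l, (1 + C (chiOdd (m (j i))) * X) := by
    rw [← Fin.prod_univ_def, ← Finset.prod_filter, Finset.filter_mem_eq_inter, Finset.univ_inter, hJ,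
      Finset.prod_map]
    rfl
  have h₅ : ((List.finRange n).filter (· ∈ J)).map c = List.ofFn fun i => c (j i) := by
    rw [hJ, filter_finRange_eq_ofFn, List.map_ofFn]
    rfl
  rw [List.ofFn_eq_map, prod_map_piecewise a m c J _ (List.sortedLT_finRange n).pairwise, h₁, h₂, h₃,
    h₄, h₅, aeval_prod_one_add, ← epsInt_neg_one_pow, ← mul_assoc, ← epsInt_mul, Finset.sum_mul,
    Finset.mul_sum, Finset.mul_sum]
  refine Finset.sum_congr rfl fun I _ => ?_
  have hη : Commute (eta F) (sym a) := commute_eta _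
  rw [← chiOdd_prod, hη.mul_pow, pow_add, mul_assoc _ (eta F ^ _ * _), ← mul_assoc (sym a ^ _) _ (_ * _),
    ← (Int.cast_commute _ (sym a ^ _)).eq, mul_assoc _ (sym a ^ _), mul_assoc (eta F ^ _),
    mul_eta_pow_mul, mul_assoc (sym a ^ (n - l))]

theorem symbol_ofFn_zpow_mul (a : Fˣ) (m : Fin n → ℤ) (c : Fin n → Fˣ) :
    symbol (List.ofFn fun i => a ^ m i * c i) =
    ∑ l ∈ Finset.range (n + 1), ∑ j : Fin l ↪o Fin n, ∑ I : Finset (Fin l),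
      epsInt F ((-1) ^ (∑ i : Fin l, (n - l + ((i : ℕ) + 1) - ((j i : ℕ) + 1))) *
        ∏ k ∈ (Finset.univ.map j.toEmbedding)ᶜ, m k) *
      ((chiOdd (∏ i ∈ I, m (j i)) : KMW F) * (eta F ^ I.card *
        (sym a ^ (n - l + I.card) * symbol (List.ofFn fun i => c (j i))))) := by
  -- The ordered product is multilinear; each factor is split into the part that keeps its unit
  -- symbol and the part `m_ε [a]`.
  have h := (MultilinearMap.mkPiAlgebraFin ℤ n (KMW F)).map_add_univ
      (fun i => sym (c i) + (chiOdd (m i) : KMW F) * (eta F * (sym a * sym (c i))))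
      (fun i => epsInt F (m i) * sym a)
  simp only [MultilinearMap.mkPiAlgebraFin_apply] at h
  rw [sum_finset_eq_sum_orderEmbedding] at h
  simp only [prod_ofFn_piecewise] at h
  rw [← h, symbol, List.map_ofFn]
  congr 2
  funext i
  rw [Function.comp_apply, sym_zpow_mul, ramifiedSym, Pi.add_apply, add_right_comm]
  rfl

end Expansion

/-! ### The residue formulas. -/

section Formula

variable {F : Type*} [Field F] {v : Valuation F ℤᵐ⁰} {π : Fˣ} {d : KMW F →+ KMW (ResField v)}

theorem map_intCast_mul {R S : Type*} [Ring R] [Ring S] (d : R →+ S) (m : ℤ) (x : R) :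
    d (m * x) = m * d x := by
  rw [← zsmul_eq_mul, map_zsmul, zsmul_eq_mul]

namespace IsResidue

variable (hd : IsResidue v π d)
include hd

theorem map_epsInt_mul_symbol (m : ℤ) (us : List v.valuationSubringˣ) :
    d (epsInt F m * symbol (us.map (inclUnit v))) = 0 := by
  have h : sym (-1) * symbol (us.map (inclUnit v)) = symbol ((-1 :: us).map (inclUnit v)) := by
    rw [List.map_cons, symbol_cons, inclUnit_neg_one]
  rw [epsInt_eq, add_mul, map_add, map_intCast_mul, hd.map_units, mul_assoc, map_intCast_mul,
    mul_assoc, hd.map_eta_mul, h, hd.map_units, mul_zero, mul_zero, mul_zero, add_zero]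

/-- The ε-integer involves `[-1]` only through `η[-1]`, and under `η` the symbols `[-1]` and `[π]`
commute, so `π` can be kept in front. -/
theorem map_epsInt_mul_symbol_cons (m : ℤ) (us : List v.valuationSubringˣ) :
    d (epsInt F m * symbol (π :: us.map (inclUnit v))) =
      epsInt (ResField v) m * symbol (us.map (redUnit v)) := by
  have h : eta F * (sym (-1) * symbol (π :: us.map (inclUnit v))) =
      eta F * symbol (π :: (-1 :: us).map (inclUnit v)) := by
    rw [List.map_cons, symbol_cons, symbol_cons, symbol_cons, inclUnit_neg_one, ← mul_assoc (sym _),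
      ← mul_assoc, eta_mul_sym_mul_sym_comm]
    simp only [mul_assoc]
  rw [epsInt_eq, epsInt_eq, add_mul, map_add, map_intCast_mul, hd.map_uniformizer, mul_assoc,
    map_intCast_mul, mul_assoc, h, hd.map_eta_mul, hd.map_uniformizer, List.map_cons, symbol_cons,
    redUnit_neg_one, add_mul]
  simp only [mul_assoc]

omit hd in
theorem sym_pow_succ_mul_symbol (r : ℕ) (us : List v.valuationSubringˣ) :
    sym π ^ (r + 1) * symbol (us.map (inclUnit v)) =
      symbol (π :: (List.replicate r (-1) ++ us).map (inclUnit v)) := by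
  induction r generalizing us with
  | zero => simp [symbol_cons]
  | succ r ih =>
    have h : List.replicate (r + 1) (-1 : v.valuationSubringˣ) ++ us =
        List.replicate r (-1) ++ (-1 :: us) := by
      rw [List.replicate_succ']
      simp
    have h₁ : sym π ^ (r + 1 + 1) = sym π ^ (r + 1) * sym (-1) := by
      rw [pow_succ, pow_succ, mul_assoc, sym_mul_self, ← mul_assoc]
    rw [h, ← ih, h₁, List.map_cons, symbol_cons, inclUnit_neg_one, mul_assoc]

theorem map_epsInt_mul_sym_pow_mul_symbol (m : ℤ) (r : ℕ) (us : List v.valuationSubringˣ) :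
    d (epsInt F m * (sym π ^ (r + 1) * symbol (us.map (inclUnit v)))) =
      epsInt (ResField v) m * symbol (List.replicate r (-1) ++ us.map (redUnit v)) := by
  rw [sym_pow_succ_mul_symbol, hd.map_epsInt_mul_symbol_cons, List.map_append, List.map_replicate,
    redUnit_neg_one]

/-- The exponent `p + 1` guarantees a factor `η`, which erases the sign and replaces the ε-integer
by its parity. -/
theorem map_epsInt_mul_eta_pow_mul (M N : ℤ) (e p r : ℕ) (us : List v.valuationSubringˣ) :
    d (epsInt F ((-1) ^ e * M) * ((chiOdd N : KMW F) * (eta F ^ (p + 1) *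
      (sym π ^ (r + 1) * symbol (us.map (inclUnit v)))))) =
    eta (ResField v) ^ (p + 1) * (chiOdd (N * M) : KMW (ResField v)) *
      symbol (List.replicate r (-1) ++ us.map (redUnit v)) := by
  have h (x : KMW F) : epsInt F ((-1) ^ e * M) * (eta F ^ (p + 1) * x) =
      (chiOdd M : KMW F) * (eta F ^ (p + 1) * x) := by
    rw [pow_succ', mul_assoc (eta F), ← mul_assoc, ← (commute_eta _).eq, eta_mul_epsInt,
      chiOdd_neg_one_pow_mul, mul_assoc]
  have h₁ := hd.map_epsInt_mul_sym_pow_mul_symbol 1 r us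
  rw [epsInt_one, epsInt_one, one_mul, one_mul] at h₁
  rw [← mul_assoc, ← (Int.cast_commute _ _).eq, mul_assoc, h, map_intCast_mul, map_intCast_mul,
    hd.map_eta_pow_mul, h₁, chiOdd_mul, Int.cast_mul,
    ← ((Int.cast_commute _ (eta _ ^ (p + 1))).mul_left (Int.cast_commute _ _)).eq]
  simp only [mul_assoc]

/-- Of `1 + η[π^m u]` only the terms containing `[π]` have a residue; they give `χ(m) η (1 + η[ū])`.
-/
theorem map_angle_mul_eta_pow (m : ℤ) (u : v.valuationSubringˣ) (i : ℕ) :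
    d (angle (π ^ m * inclUnit v u) * eta F ^ i) =
      angle (redUnit v u) * eta (ResField v) ^ (i + 1) * (chiOdd m : KMW (ResField v)) := by
  have h₁ : d 1 = 0 := by simpa [symbol] using hd.map_units []
  have h₂ : d (sym (inclUnit v u)) = 0 := by simpa [symbol] using hd.map_units [u]
  have h₃ : d (sym π) = 1 := by simpa [symbol] using hd.map_uniformizer []
  have h₄ : d (sym π * sym (inclUnit v u)) = sym (redUnit v u) := by
    simpa [symbol] using hd.map_uniformizer [u]
  have h₅ : eta F * (epsInt F m * sym π) = (chiOdd m : KMW F) * (eta F * sym π) := by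
    rw [← mul_assoc, eta_mul_epsInt, mul_assoc]
  have hχ (x y : KMW (ResField v)) :
      x * ((chiOdd m : KMW (ResField v)) * y) = (chiOdd m : KMW (ResField v)) * (x * y) := by
    rw [← mul_assoc, ← (Int.cast_commute _ x).eq, mul_assoc]
  rw [← ((commute_eta _).pow_left i).eq, hd.map_eta_pow_mul, angle, map_add, h₁, zero_add,
    sym_zpow_mul, ramifiedSym, RingHom.id_apply, RingHom.id_apply, RingHom.id_apply, mul_add,
    mul_add, h₅, map_add, map_add, hd.map_eta_mul, h₂, mul_zero, zero_add, map_intCast_mul,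
    hd.map_eta_mul, h₃, mul_one, hd.map_eta_mul, map_intCast_mul, hd.map_eta_mul, h₄, angle,
    ← (Int.cast_commute _ (_ * _)).eq, ← ((commute_eta _).pow_left (i + 1)).eq,
    hχ, ← mul_add, hχ, ← mul_one_add, pow_succ, mul_assoc (eta _ ^ i)]

theorem map_symbol_ofFn {n : ℕ} (m : Fin n → ℤ) (u : Fin n → v.valuationSubringˣ) :
    d (symbol (List.ofFn fun i => π ^ m i * inclUnit v (u i))) =
      (∑ l ∈ Finset.range n, ∑ j : Fin l ↪o Fin n,
        epsInt (ResField v)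
          ((-1) ^ (∑ i : Fin l, (n - l + ((i : ℕ) + 1) - ((j i : ℕ) + 1))) *
            ∏ k ∈ (Finset.univ.map j.toEmbedding)ᶜ, m k) *
        symbol (List.replicate (n - 1 - l) (-1) ++
          List.ofFn fun i => redUnit v (u (j i)))) +
      ∑ p ∈ Finset.Icc 1 n, ∑ l ∈ Finset.Icc p n, ∑ j : Fin l ↪o Fin n,
        (∑ I ∈ Finset.powersetCard p (Finset.univ : Finset (Fin l)),
          eta (ResField v) ^ p *
            (chiOdd ((∏ i ∈ I, m (j i)) *
              ∏ k ∈ (Finset.univ.map j.toEmbedding)ᶜ, m k) : KMW (ResField v))) *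
        symbol (List.replicate (n - 1 + p - l) (-1) ++
          List.ofFn fun i => redUnit v (u (j i))) := by
  have hi {l : ℕ} (j : Fin l ↪o Fin n) : (List.ofFn fun i => inclUnit v (u (j i))) =
      (List.ofFn fun i => u (j i)).map (inclUnit v) := by rw [List.map_ofFn]; rfl
  have hr {l : ℕ} (j : Fin l ↪o Fin n) : (List.ofFn fun i => redUnit v (u (j i))) =
      (List.ofFn fun i => u (j i)).map (redUnit v) := by rw [List.map_ofFn]; rfl
  rw [symbol_ofFn_zpow_mul]
  simp only [map_sum, hi, hr]
  -- Empty `I` feeds the first sum of the formula, and `I` of size `p ≥ 1` the second.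
  have hsplit {l : ℕ} (f : Finset (Fin l) → KMW (ResField v)) :
      ∑ I, f I = f ∅ + ∑ p ∈ Finset.Icc 1 l, ∑ I ∈ Finset.powersetCard p Finset.univ, f I := by
    rw [← Finset.powerset_univ, Finset.sum_powerset, Finset.card_univ, Fintype.card_fin,
      Finset.sum_range_succ', Finset.powersetCard_zero, Finset.sum_singleton, add_comm,
      Finset.range_eq_Ico, Finset.sum_Ico_add' (fun p => ∑ I ∈ Finset.powersetCard p _, f I)]
    rfl
  simp only [hsplit, Finset.sum_add_distrib]
  congr 1
  -- For `l = n` and `I` empty no `[π]` is present, so the residue is zero; this is why the first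
  -- sum stops at `l = n - 1`.
  · rw [Finset.sum_range_succ, add_eq_left.mpr]
    · refine Finset.sum_congr rfl fun l hl => Finset.sum_congr rfl fun j _ => ?_
      have hl : n - l = n - 1 - l + 1 := by have := Finset.mem_range.mp hl; omega
      simp only [Finset.prod_empty, Finset.card_empty, pow_zero, one_mul, add_zero, hl]
      rw [show chiOdd 1 = 1 from rfl, Int.cast_one, one_mul, hd.map_epsInt_mul_sym_pow_mul_symbol]
    · refine Finset.sum_eq_zero fun j _ => ?_
      simp only [Finset.prod_empty, Finset.card_empty, pow_zero, one_mul, add_zero, Nat.sub_self]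
      rw [show chiOdd 1 = 1 from rfl, Int.cast_one, one_mul, hd.map_epsInt_mul_symbol]
  · simp only [Finset.sum_comm (s := (Finset.univ : Finset (Fin _ ↪o Fin n)))]
    -- Both orders of summation run over `1 ≤ p ≤ l ≤ n`.
    rw [Finset.sum_comm' (t' := Finset.Icc 1 n) (s' := fun p => Finset.Icc p n)]
    · refine Finset.sum_congr rfl fun p hp => Finset.sum_congr rfl fun l hl => ?_
      rw [Finset.sum_comm]
      refine Finset.sum_congr rfl fun j _ => ?_
      rw [Finset.sum_mul]
      refine Finset.sum_congr rfl fun I hI => ?_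
      obtain ⟨hp, -⟩ := Finset.mem_Icc.mp hp
      obtain ⟨hpl, hl⟩ := Finset.mem_Icc.mp hl
      rw [(Finset.mem_powersetCard.mp hI).2]
      obtain ⟨q, rfl⟩ : ∃ q, p = q + 1 := ⟨p - 1, by omega⟩
      -- The exponent of `[π]` is positive; one copy is consumed by the residue and the others
      -- become `[-1]`.
      have hr : n - l + (q + 1) = n - 1 + (q + 1) - l + 1 := by omega
      rw [hr, hd.map_epsInt_mul_eta_pow_mul]
    · intro l p
      simp only [Finset.mem_range, Finset.mem_Icc]
      omega

end IsResidue

end Formula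

end MilnorWitt

end
open MilnorWitt in
theorem mainTheorem10 {F : Type*} [Field F] (v : Valuation F ℤᵐ⁰) [v.IsRankOneDiscrete]
    (π : Fˣ) (hπ : v.IsUniformizer (π : F)) :
    (∃! d : KMW F →+ KMW (ResField v), IsResidue v π d) ∧
    ∀ d : KMW F →+ KMW (ResField v), IsResidue v π d →
      (∀ n : ℤ, n ≤ 0 → ∀ (m : ℤ) (u : v.valuationSubringˣ),
        d (angle (π ^ m * inclUnit v u) * eta F ^ (-n).toNat) =
          angle (redUnit v u) * eta (ResField v) ^ (-n + 1).toNat *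
            (chiOdd m : KMW (ResField v))) ∧
      (∀ n : ℕ, 1 ≤ n → ∀ (m : Fin n → ℤ) (u : Fin n → v.valuationSubringˣ),
        d (symbol (List.ofFn fun i => π ^ m i * inclUnit v (u i))) =
          (∑ l ∈ Finset.range n, ∑ j : Fin l ↪o Fin n,
            epsInt (ResField v)
              ((-1) ^ (∑ i : Fin l, (n - l + ((i : ℕ) + 1) - ((j i : ℕ) + 1))) *
                ∏ k ∈ (Finset.univ.map j.toEmbedding)ᶜ, m k) *
            symbol (List.replicate (n - 1 - l) (-1) ++
              List.ofFn fun i => redUnit v (u (j i)))) +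
          ∑ p ∈ Finset.Icc 1 n, ∑ l ∈ Finset.Icc p n, ∑ j : Fin l ↪o Fin n,
            (∑ I ∈ Finset.powersetCard p (Finset.univ : Finset (Fin l)),
              eta (ResField v) ^ p *
                (chiOdd ((∏ i ∈ I, m (j i)) *
                  ∏ k ∈ (Finset.univ.map j.toEmbedding)ᶜ, m k) : KMW (ResField v))) *
            symbol (List.replicate (n - 1 + p - l) (-1) ++
              List.ofFn fun i => redUnit v (u (j i)))) := by
  obtain ⟨d, hd⟩ := exists_isResidue hπ
  refine ⟨⟨d, hd, fun d' hd' => hd'.unique hπ hd⟩, fun d hd => ⟨fun n hn m u => ?_,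
    fun n _ m u => hd.map_symbol_ofFn m u⟩⟩
  have h : (-n + 1).toNat = (-n).toNat + 1 := by omega
  rw [h, hd.map_angle_mul_eta_pow]
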